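/- All graphs are finite and simple. Let $K_r$ be the complete graph on $r$ vertices, $P_\ell$ the path with $\ell$ vertices, and $kP_\ell$ the vertex-disjoint union of $k$ copies of $P_\ell$. For graphs $F,H$ let $ex(n,\{F,H\})$ be the maximum number of edges of an $n$-vertex graph containing neither $F$ nor $H$ as a (not necessarily induced) subgraph. Let $T(m,s)$ be the Turán graph, i.e. the complete $s$-partite graph on $m$ vertices with parts of size $\lfloor m/s\rfloor$ or $\lceil m/s\rceil$, and let $e(T(m,s))$ be its number of edges (so $e(T(m,s))=\binom m2$ if $s\ge m$). Let $k\ge 2$ and $\ell\ge 4$, let $r\ge 3$, and let $$n\ \ge\ 4k^2\ell^2(k\ell+r)\left(\left\lfloor\tfrac{\ell}{2}\right\rfloor+1\right)\binom{\ell}{\lfloor \ell/2\rfloor}.$$ (i) If $r=3$, then $$ex(n,\{K_3,kP_\ell\})=\left(n-k\left\lfloor\tfrac{\ell}{2}\right\rfloor+1\right)\left(k\left\lfloor\tfrac{\ell}{2}\right\rfloor-1\right).$$ (ii) If $4\le r\le k\lfloor \ell/2\rfloor+1$, then $$ex(n,\{K_r,kP_\ell\})=\left(n-k\left\lfloor\tfrac{\ell}{2}\right\rfloor+1\right)\left(k\left\lfloor\tfrac{\ell}{2}\right\rfloor-1\right)+e\left(T\left(k\left\lfloor\tfrac{\ell}{2}\right\rfloor-1,\,r-2\right)\right).$$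 (iii) If $r\ge k\lfloor \ell/2\rfloor+2$, then $$ex(n,\{K_r,kP_\ell\})=\left(n-k\left\lfloor\tfrac{\ell}{2}\right\rfloor+1\right)\left(k\left\lfloor\tfrac{\ell}{2}\right\rfloor-1\right)+\binom{k\lfloor \ell/2\rfloor-1}{2}+D_\ell,$$ where $D_\ell=1$ if $\ell$ is odd and $D_\ell=0$ if $\ell$ is even. -/

import Mathlib

/-- `disjointCopies k H` is the graph `k H`, the vertex-disjoint union of `k` copies of `H`:
the vertex `(i, v)` is the vertex `v` of the `i`-th copy. -/
def disjointCopies {V : Type*} (k : ℕ) (H : SimpleGraph V) : SimpleGraph (Fin k × V) where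
  Adj p q := p.1 = q.1 ∧ H.Adj p.2 q.2
  symm := ⟨fun _ _ h => ⟨h.1.symm, h.2.symm⟩⟩
  loopless := ⟨fun _ h => H.irrefl h.2⟩

open scoped Classical in
/-- The Turán number `ex(n, {F, H})`: the maximum number of edges of a graph on `n` vertices that
contains neither `F` nor `H` as a (not necessarily induced) subgraph. -/
noncomputable def turanNumberPair {V W : Type*} (n : ℕ) (F : SimpleGraph V) (H : SimpleGraph W) :
    ℕ :=
  Finset.sup {G : SimpleGraph (Fin n) | F.Free G ∧ H.Free G} (fun G => G.edgeFinset.card)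

open Finset

set_option linter.unusedSectionVars false

/-! Write h = ⌊ℓ/2⌋ and m = kh - 1. For the lower bound, m vertices carrying a Turán graph or a
clique are joined to all others, which span no edge, or a single one if ℓ is odd and r is large.
Every ℓ-vertex path uses at least h of the m vertices, so k disjoint ones do not fit.

For the upper bound, let G have at least (n - m)m edges and no k disjoint ℓ-vertex paths, hence none
on 2h + 1 vertices. The heart is `exists_core`: some m vertices have many common neighbours. By
density, some path on 2h + 1 vertices has many vertices with h neighbours on it, and pigeonhole
yields h vertices with many common neighbours. Deleting them lowers the packing number, since an
alternating path through them could complement any packing that avoids them. After k - 1 rounds, a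
set A of (k - 1)h vertices is gone and no path on 2h + 1 vertices is left (`exists_stripped`).

The missing h - 1 vertices lie on a longest path of the rest. Vertices of small degree and small
components are pruned (`exists_pruned`); the Erdős–Gallai bound then shows that the set B of
remaining vertices joined to all of A is large. A longest path now has an end in B and 2h - 1 or 2h
vertices, and outside it all but two vertices of B have all their remaining neighbours, at least h -
1 of them, on it (`card_bad_le_two`). Pigeonhole applies again.

Given such a core U, any ℓ-vertex path with at most h - 1 vertices in U can be completed to k
disjoint paths (`packs_of_path`). Hence the edges not inside U number at most (n - m)m, plus one
exceptional edge (`load_le_of_core`), which is impossible for even ℓ. Edges inside U are bounded by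
Turán's theorem or trivially; in the K_r-free case an exceptional edge makes U free of K_{r-2},
which costs an edge inside U. -/

namespace DisjointPaths

/-! ### Counting edges inside vertex sets -/

section

variable {V : Type*} [DecidableEq V] (G : SimpleGraph V) [DecidableRel G.Adj]

/-- The number of neighbours of `v` in `Y`. -/
def degIn (Y : Finset V) (v : V) : ℕ := #{w ∈ Y | G.Adj v w}

/-- Twice the number of edges of `G` inside `Y`. -/
def twiceEdges (Y : Finset V) : ℕ := ∑ v ∈ Y, degIn G Y v

variable {G}

lemma degIn_le_card (Y : Finset V) (v : V) : degIn G Y v ≤ #Y := card_filter_le _ _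

lemma degIn_mono {Y Z : Finset V} (h : Y ⊆ Z) (v : V) : degIn G Y v ≤ degIn G Z v :=
  card_le_card (filter_subset_filter _ h)

lemma degIn_union {A Y : Finset V} (h : Disjoint A Y) (v : V) :
    degIn G (A ∪ Y) v = degIn G A v + degIn G Y v := by
  rw [degIn, filter_union, card_union_of_disjoint (disjoint_filter_filter h)]
  rfl

lemma degIn_le_card_sub_one {Y : Finset V} {v : V} (h : v ∈ Y) : degIn G Y v ≤ #Y - 1 := by
  rw [← card_erase_of_mem h]
  refine card_le_card fun w hw => ?_
  rw [mem_filter] at hw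
  exact mem_erase.2 ⟨hw.2.ne', hw.1⟩

lemma degIn_eq_card_iff {A : Finset V} {v : V} : degIn G A v = #A ↔ ∀ a ∈ A, G.Adj v a :=
  card_filter_eq_iff

lemma degIn_eq_zero_iff {A : Finset V} {v : V} : degIn G A v = 0 ↔ ∀ a ∈ A, ¬G.Adj v a := by
  simp [degIn, filter_eq_empty_iff]

lemma exists_adj_of_degIn_pos {A : Finset V} {v : V} (h : 0 < degIn G A v) :
    ∃ a ∈ A, G.Adj v a := by
  obtain ⟨a, ha⟩ := card_pos.1 h
  exact ⟨a, (mem_filter.1 ha).1, (mem_filter.1 ha).2⟩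

lemma degIn_singleton (v w : V) : degIn G {v} w = if G.Adj w v then 1 else 0 := by
  simp only [degIn, filter_singleton]
  split_ifs <;> rfl

lemma sum_degIn_comm (A Y : Finset V) : ∑ v ∈ Y, degIn G A v = ∑ a ∈ A, degIn G Y a := by
  have h := sum_card_bipartiteAbove_eq_sum_card_bipartiteBelow (s := Y) (t := A) G.Adj
  refine h.trans (sum_congr rfl fun a _ => ?_)
  simp only [degIn, bipartiteBelow, G.adj_comm a]

lemma twiceEdges_union {A Y : Finset V} (h : Disjoint A Y) :
    twiceEdges G (A ∪ Y) = twiceEdges G A + twiceEdges G Y + 2 * ∑ v ∈ Y, degIn G A v := by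
  simp only [twiceEdges, sum_union h, degIn_union h, sum_add_distrib]
  have := sum_degIn_comm (G := G) A Y
  omega

lemma twiceEdges_sdiff {A Y : Finset V} (h : A ⊆ Y) :
    twiceEdges G Y = twiceEdges G A + twiceEdges G (Y \ A) + 2 * ∑ v ∈ Y \ A, degIn G A v := by
  rw [← twiceEdges_union disjoint_sdiff, union_sdiff_of_subset h]

lemma twiceEdges_singleton (v : V) : twiceEdges G {v} = 0 := by
  simp [twiceEdges, degIn_singleton]

lemma twiceEdges_erase {Y : Finset V} {v : V} (h : v ∈ Y) :
    twiceEdges G Y = twiceEdges G (Y.erase v) + 2 * degIn G Y v := by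
  have h1 := twiceEdges_sdiff (G := G) (singleton_subset_iff.2 h)
  have h2 : degIn G Y v = degIn G {v} v + degIn G (Y \ {v}) v := by
    rw [← degIn_union disjoint_sdiff, union_sdiff_of_subset (singleton_subset_iff.2 h)]
  rw [sum_degIn_comm, sum_singleton, twiceEdges_singleton, sdiff_singleton_eq_erase] at h1
  rw [degIn_singleton, if_neg G.irrefl, sdiff_singleton_eq_erase] at h2
  omega

lemma twiceEdges_le {Y : Finset V} {d : ℕ} (h : ∀ v ∈ Y, degIn G Y v ≤ d) :
    twiceEdges G Y ≤ #Y * d :=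
  (sum_le_card_nsmul Y _ d h).trans_eq (smul_eq_mul _ _)

lemma twiceEdges_le_card (Y : Finset V) : twiceEdges G Y ≤ #Y * (#Y - 1) :=
  twiceEdges_le fun _ h => degIn_le_card_sub_one h

lemma twiceEdges_closed {K Y : Finset V} (h : K ⊆ Y)
    (hK : ∀ v ∈ K, ∀ w ∈ Y, G.Adj v w → w ∈ K) :
    twiceEdges G Y = twiceEdges G K + twiceEdges G (Y \ K) := by
  rw [twiceEdges_sdiff h, sum_eq_zero fun v hv => ?_, mul_zero, add_zero]
  rw [degIn_eq_zero_iff]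
  exact fun a ha hva => (mem_sdiff.1 hv).2 (hK a ha v (mem_sdiff.1 hv).1 hva.symm)

lemma degIn_comap {W : Type*} [Fintype W] (f : W ↪ V) [DecidableRel (G.comap f).Adj] (w : W) :
    degIn G (univ.map f) (f w) = (G.comap f).degree w := by
  rw [degIn, filter_map, card_map, ← SimpleGraph.card_neighborFinset_eq_degree,
    SimpleGraph.neighborFinset_eq_filter]
  exact congrArg card (filter_congr fun _ _ => Iff.rfl)

lemma twiceEdges_map {W : Type*} [Fintype W] (f : W ↪ V) [DecidableRel (G.comap f).Adj] :
    twiceEdges G (univ.map f) = 2 * #(G.comap f).edgeFinset := by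
  rw [twiceEdges, sum_map, ← SimpleGraph.sum_degrees_eq_twice_card_edges]
  exact sum_congr rfl fun w _ => degIn_comap f w

lemma twiceEdges_univ [Fintype V] : twiceEdges G univ = 2 * #G.edgeFinset := by
  rw [← SimpleGraph.sum_degrees_eq_twice_card_edges, twiceEdges]
  refine sum_congr rfl fun w _ => ?_
  rw [degIn, ← SimpleGraph.card_neighborFinset_eq_degree, SimpleGraph.neighborFinset_eq_filter]

/-- If every vertex of `X` has at least `c` neighbours in `S`, then many vertices of `X` share
`c` neighbours in `S`. -/
lemma exists_common_neighbors {S X : Finset V} {c s t : ℕ} (hS : #S ≤ s)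
    (hX : ∀ v ∈ X, c ≤ degIn G S v) (hc : s.choose c * t < #X) :
    ∃ A ⊆ S, #A = c ∧ ∃ W ⊆ X, t ≤ #W ∧ ∀ a ∈ A, ∀ w ∈ W, G.Adj a w := by
  have hsub : ∀ v : V, ∃ A : Finset V, v ∈ X → A ⊆ {w ∈ S | G.Adj v w} ∧ #A = c := fun v => by
    by_cases hv : v ∈ X
    · obtain ⟨A, hA⟩ := exists_subset_card_eq (hX v hv)
      exact ⟨A, fun _ => hA⟩
    · exact ⟨∅, fun h => absurd h hv⟩
  choose F hF using hsub
  have hmaps : ∀ v ∈ X, F v ∈ S.powersetCard c := fun v hv =>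
    mem_powersetCard.2 ⟨(hF v hv).1.trans (filter_subset _ _), (hF v hv).2⟩
  have hcard : #(S.powersetCard c) * t < #X := by
    rw [card_powersetCard]
    exact (Nat.mul_le_mul_right _ (Nat.choose_le_choose c hS)).trans_lt hc
  -- Pigeonhole: more than `t` vertices of `X` have chosen the same `c`-subset of `S`.
  obtain ⟨A, hA, ht⟩ := exists_lt_card_fiber_of_mul_lt_card_of_maps_to hmaps hcard
  refine ⟨A, (mem_powersetCard.1 hA).1, (mem_powersetCard.1 hA).2, _, filter_subset _ _, ht.le,
    fun a ha v hv => ?_⟩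
  rw [mem_filter] at hv
  exact (mem_filter.1 ((hF v hv.1).1 (hv.2 ▸ ha))).2.symm

end

/-! ### Paths as vertex lists, longest paths and the Erdős–Gallai bound -/

section

variable {V : Type*} (G : SimpleGraph V)

/-- The list `l` is the vertex list of a path of `G` inside `Y`. -/
structure IsPathIn (Y : Finset V) (l : List V) : Prop where
  chain : l.IsChain G.Adj
  nodup : l.Nodup
  mem : ∀ v ∈ l, v ∈ Y

namespace IsPathIn

variable {G} {Y Z : Finset V} {l : List V}

lemma mono (h : IsPathIn G Y l) (hYZ : Y ⊆ Z) : IsPathIn G Z l :=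
  ⟨h.chain, h.nodup, fun v hv => hYZ (h.mem v hv)⟩

lemma reverse (h : IsPathIn G Y l) : IsPathIn G Y l.reverse := by
  refine ⟨?_, List.nodup_reverse.2 h.nodup, fun v hv => h.mem v (List.mem_reverse.1 hv)⟩
  rw [List.isChain_reverse]
  exact h.chain.imp fun _ _ hab => hab.symm

lemma take (h : IsPathIn G Y l) (n : ℕ) : IsPathIn G Y (l.take n) :=
  ⟨h.chain.take n, h.nodup.sublist (List.take_sublist _ _), fun v hv =>
    h.mem v (List.mem_of_mem_take hv)⟩

lemma cons {x y : V} (h : IsPathIn G Y (y :: l)) (hxy : G.Adj x y) (hx : x ∈ Y)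
    (hxl : x ∉ y :: l) : IsPathIn G Y (x :: y :: l) :=
  ⟨List.isChain_cons_cons.2 ⟨hxy, h.chain⟩, List.nodup_cons.2 ⟨hxl, h.nodup⟩,
    List.forall_mem_cons.2 ⟨hx, h.mem⟩⟩

lemma singleton {x : V} (hx : x ∈ Y) : IsPathIn G Y [x] :=
  ⟨List.isChain_singleton x, List.nodup_singleton x, by simpa using hx⟩

lemma pair {x y : V} (hx : x ∈ Y) (hy : y ∈ Y) (hxy : G.Adj x y) : IsPathIn G Y [x, y] :=
  (singleton hy).cons hxy hx (by simpa using hxy.ne)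

/-- Two disjoint paths whose first vertices are joined to `a`. -/
lemma join {x y a : V} {s t : List V} (hs : IsPathIn G Y (x :: s)) (ht : IsPathIn G Y (y :: t))
    (hax : G.Adj a x) (hay : G.Adj a y) (ha : a ∈ Y) (has : a ∉ x :: s) (hat : a ∉ y :: t)
    (hd : List.Disjoint (x :: s) (y :: t)) :
    IsPathIn G Y ((x :: s).reverse ++ a :: y :: t) := by
  have h1 := ht.cons hay ha hat
  refine ⟨List.isChain_append.2 ⟨hs.reverse.chain, h1.chain, ?_⟩,
    List.nodup_append.2 ⟨hs.reverse.nodup, h1.nodup, ?_⟩, fun v hv => ?_⟩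
  · intro u hu v hv
    simp only [List.getLast?_reverse, List.head?_cons, Option.mem_some] at hu hv
    subst hu hv
    exact hax.symm
  · rintro u hu v hv rfl
    rw [List.mem_reverse] at hu
    rcases List.mem_cons.1 hv with rfl | hv
    · exact has hu
    · exact hd hu hv
  · rcases List.mem_append.1 hv with hv | hv
    · exact hs.reverse.mem v hv
    · exact h1.mem v hv

variable [DecidableEq V]

lemma toFinset_subset (h : IsPathIn G Y l) : l.toFinset ⊆ Y := fun v hv =>
  h.mem v (List.mem_toFinset.1 hv)

lemma length_le_card (h : IsPathIn G Y l) : l.length ≤ #Y := by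
  rw [← List.toFinset_card_of_nodup h.nodup]
  exact card_le_card h.toFinset_subset

/-- A vertex outside a cycle and adjacent to it gives a longer path. -/
lemma exists_of_cycle (h : IsPathIn G Y l) (hne : l ≠ []) (hc : G.Adj (l.getLast hne) (l.head hne))
    {v w : V} (hv : v ∈ l) (hw : w ∈ Y) (hwl : w ∉ l) (hvw : G.Adj v w) :
    ∃ l', IsPathIn G Y l' ∧ l'.length = l.length + 1 := by
  obtain ⟨s, t, rfl⟩ := List.append_of_mem hv
  refine ⟨w :: v :: (t ++ s), IsPathIn.cons ⟨?_, ?_, ?_⟩ hvw.symm hw ?_, ?_⟩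
  · obtain ⟨h1, h2, h3⟩ := List.isChain_append.1 h.chain
    rw [← List.cons_append]
    refine List.isChain_append.2 ⟨h2, h1, fun x hx y hy => ?_⟩
    have hy' : (s ++ v :: t).head hne = y := by
      cases s with
      | nil => simp at hy
      | cons a s => simpa using hy
    have hx' : (s ++ v :: t).getLast hne = x := by
      rw [List.getLast_append_of_ne_nil _ (List.cons_ne_nil v t)]
      rw [Option.mem_def, List.getLast?_eq_getLast_of_ne_nil (List.cons_ne_nil v t)] at hx
      exact Option.some.inj hx
    rw [hx', hy'] at hc
    exact hc
  · rw [← List.cons_append]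
    exact List.nodup_append_comm.1 h.nodup
  · intro u hu
    refine h.mem u ?_
    simp only [List.mem_cons, List.mem_append] at hu ⊢
    tauto
  · intro hu
    refine hwl ?_
    simp only [List.mem_cons, List.mem_append] at hu ⊢
    tauto
  · simp
    omega

variable [DecidableRel G.Adj]

lemma mem_of_adj_head (h : IsPathIn G Y l) (hmax : ∀ l', IsPathIn G Y l' → l'.length ≤ l.length)
    (hne : l ≠ []) {w : V} (hw : w ∈ Y) (hadj : G.Adj (l.head hne) w) : w ∈ l := by
  by_contra hwl
  cases l with
  | nil => exact hne rfl
  | cons a l => simpa using hmax _ (h.cons hadj.symm hw hwl)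

lemma mem_of_adj_getLast (h : IsPathIn G Y l)
    (hmax : ∀ l', IsPathIn G Y l' → l'.length ≤ l.length)
    (hne : l ≠ []) {w : V} (hw : w ∈ Y) (hadj : G.Adj (l.getLast hne) w) : w ∈ l := by
  have := h.reverse.mem_of_adj_head (by simpa using hmax) (by simpa using hne) hw (by simpa)
  simpa using this

/-- If the degrees of the ends of a longest path of `G` inside `Y` add up to its number of vertices,
then there is no edge between this path and the rest of `Y`. -/
lemma closed_of_longest (h : IsPathIn G Y l)
    (hmax : ∀ l', IsPathIn G Y l' → l'.length ≤ l.length) (hne : l ≠ [])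
    (hdeg : l.length ≤ degIn G Y (l.head hne) + degIn G Y (l.getLast hne)) :
    ∀ v ∈ l, ∀ w ∈ Y, G.Adj v w → w ∈ l := by
  set x := l.head hne with hx
  set z := l.getLast hne with hz
  have hpos : 0 < l.length := List.length_pos_iff.2 hne
  have hx0 : l[0] = x := by rw [hx, List.head_eq_getElem]
  have hz0 : l[l.length - 1] = z := by rw [hz, List.getLast_eq_getElem]
  -- By maximality, all neighbours of both ends lie on the path. Those of `x` are indexed by the
  -- preceding position, those of `z` by their own, so two large sets among `l.length - 1` positions
  -- must meet. The default of `getD` is never reached.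
  have hS : degIn G Y x ≤ #{i ∈ range (l.length - 1) | G.Adj x (l.getD (i + 1) x)} := by
    refine (card_le_card fun w hw => ?_).trans
      (card_image_le (f := fun i => l.getD (i + 1) x))
    obtain ⟨hwY, hw⟩ := mem_filter.1 hw
    obtain ⟨j, hj, rfl⟩ := List.getElem_of_mem (h.mem_of_adj_head hmax hne hwY hw)
    have hj0 : j ≠ 0 := by
      rintro rfl
      exact hw.ne hx0.symm
    obtain ⟨i, rfl⟩ := Nat.exists_eq_succ_of_ne_zero hj0
    have hg : l.getD (i + 1) x = l[i + 1] := List.getD_eq_getElem _ _ hj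
    refine mem_image.2 ⟨i, mem_filter.2 ⟨mem_range.2 (by omega), ?_⟩, hg⟩
    rw [hg]
    exact hw
  have hT : degIn G Y z ≤ #{i ∈ range (l.length - 1) | G.Adj z (l.getD i x)} := by
    refine (card_le_card fun w hw => ?_).trans (card_image_le (f := fun i => l.getD i x))
    obtain ⟨hwY, hw⟩ := mem_filter.1 hw
    obtain ⟨j, hj, rfl⟩ := List.getElem_of_mem (h.mem_of_adj_getLast hmax hne hwY hw)
    have hj0 : j ≠ l.length - 1 := by
      rintro rfl
      exact hw.ne hz0.symm
    have hg : l.getD j x = l[j] := List.getD_eq_getElem _ _ hj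
    refine mem_image.2 ⟨j, mem_filter.2 ⟨mem_range.2 (by omega), ?_⟩, hg⟩
    rw [hg]
    exact hw
  obtain ⟨i, hiS, hiT⟩ : ∃ i, i ∈ {i ∈ range (l.length - 1) | G.Adj x (l.getD (i + 1) x)} ∧
      i ∈ {i ∈ range (l.length - 1) | G.Adj z (l.getD i x)} := by
    by_contra! hcon
    have hdis : Disjoint {i ∈ range (l.length - 1) | G.Adj x (l.getD (i + 1) x)}
        {i ∈ range (l.length - 1) | G.Adj z (l.getD i x)} := disjoint_left.2 hcon
    have := card_le_card (union_subset (filter_subset _ _) (filter_subset _ _) :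
      {i ∈ range (l.length - 1) | G.Adj x (l.getD (i + 1) x)} ∪
        {i ∈ range (l.length - 1) | G.Adj z (l.getD i x)} ⊆ range (l.length - 1))
    rw [card_union_of_disjoint hdis, card_range] at this
    omega
  rw [mem_filter, mem_range] at hiS hiT
  have hi1 : i + 1 < l.length := by omega
  have hxi := hiS.2
  have hzi := hiT.2
  rw [List.getD_eq_getElem _ _ hi1] at hxi
  rw [List.getD_eq_getElem _ _ (by omega)] at hzi
  -- As `x` is adjacent to position `i + 1` and `z` to position `i`, reversing the tail turns the
  -- path into a cycle on the same vertices; an edge leaving it would give a longer path.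
  have hl : l = l.take (i + 1) ++ l.drop (i + 1) := (List.take_append_drop _ _).symm
  have hne1 : l.take (i + 1) ≠ [] := by simpa using hne
  have hne2 : l.drop (i + 1) ≠ [] := by simpa using hi1
  have hne3 : (l.drop (i + 1)).reverse ≠ [] := by simpa using hi1
  have hcne : l.take (i + 1) ++ (l.drop (i + 1)).reverse ≠ [] := by simp [hne]
  have hmem : ∀ u, u ∈ l.take (i + 1) ++ (l.drop (i + 1)).reverse ↔ u ∈ l := fun u => by
    conv_rhs => rw [hl]
    simp only [List.mem_append, List.mem_reverse]
  have hpath : IsPathIn G Y (l.take (i + 1) ++ (l.drop (i + 1)).reverse) := by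
    refine ⟨List.isChain_append.2 ⟨h.chain.take _, ?_, ?_⟩, ?_, fun u hu =>
      h.mem u ((hmem u).1 hu)⟩
    · rw [List.isChain_reverse]
      exact (h.chain.drop _).imp fun _ _ hab => hab.symm
    · intro u hu v hv
      rw [List.head?_reverse, List.getLast?_drop, if_neg (by omega), Option.mem_def,
        List.getLast?_eq_getLast_of_ne_nil hne, Option.some_inj] at hv
      rw [Option.mem_def, List.getLast?_eq_getLast_of_ne_nil hne1, Option.some_inj,
        List.getLast_eq_getElem, List.getElem_take] at hu
      subst hu hv
      have : (l.take (i + 1)).length - 1 = i := by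
        rw [List.length_take]
        omega
      simp only [this]
      exact hzi.symm
    · have := h.nodup
      rw [hl, List.nodup_append] at this
      refine List.nodup_append.2 ⟨this.1, List.nodup_reverse.2 this.2.1, fun u hu v hv =>
        this.2.2 u hu v (List.mem_reverse.1 hv)⟩
  intro v hv w hw hvw
  by_contra hwl
  obtain ⟨l', hl', hlen⟩ := hpath.exists_of_cycle hcne (by
      rw [List.getLast_append_of_ne_nil _ hne3, List.getLast_reverse, List.head_append_of_ne_nil hne1,
        List.head_take, List.head_drop]
      exact hxi.symm) ((hmem v).2 hv) hw (fun hu => hwl ((hmem w).1 hu)) hvw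
  have := hmax l' hl'
  rw [hlen, List.length_append, List.length_reverse, ← List.length_append, ← hl] at this
  omega

end IsPathIn

variable {G} [DecidableEq V]

lemma exists_longest_path {Y : Finset V} (hY : Y.Nonempty) :
    ∃ l, IsPathIn G Y l ∧ l ≠ [] ∧ ∀ l', IsPathIn G Y l' → l'.length ≤ l.length := by
  classical
  obtain ⟨y, hy⟩ := hY
  have hex : ∃ n, ∃ l, IsPathIn G Y l ∧ l.length = n := ⟨1, [y], .singleton hy, rfl⟩
  have hbd : ∀ n, (∃ l, IsPathIn G Y l ∧ l.length = n) → n ≤ #Y := by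
    rintro _ ⟨l, hl, rfl⟩
    exact hl.length_le_card
  have h1 := Nat.findGreatest_spec (P := fun n => ∃ l, IsPathIn G Y l ∧ l.length = n)
    (hbd 1 ⟨[y], .singleton hy, rfl⟩) ⟨[y], .singleton hy, rfl⟩
  obtain ⟨l, hl, hlen⟩ := h1
  have hmax : ∀ l', IsPathIn G Y l' → l'.length ≤ l.length := fun l' hl' => by
    rw [hlen]
    exact Nat.le_findGreatest hl'.length_le_card ⟨l', hl', rfl⟩
  refine ⟨l, hl, ?_, hmax⟩
  rintro rfl
  simpa using hmax [y] (.singleton hy)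

variable [DecidableRel G.Adj]

/-- The Erdős–Gallai bound for paths with an odd number of vertices. -/
theorem twiceEdges_le_of_no_path {h : ℕ} (Y : Finset V)
    (hY : ∀ l, IsPathIn G Y l → l.length ≤ 2 * h) : twiceEdges G Y ≤ (2 * h - 1) * #Y := by
  induction Y using Finset.strongInduction with
  | H Y ih =>
  rcases Y.eq_empty_or_nonempty with rfl | hne
  · simp [twiceEdges]
  have hsub : ∀ Z ⊂ Y, twiceEdges G Z ≤ (2 * h - 1) * #Z := fun Z hZ =>
    ih Z hZ fun l hl => hY l (hl.mono hZ.1)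
  -- A vertex of degree at most `h - 1` can be deleted. Otherwise the end degrees of a longest path
  -- add up to at least `2 * h`, so the path spans a closed set of at most `2 * h` vertices, which
  -- can be deleted.
  by_cases hdeg : ∃ v ∈ Y, degIn G Y v < h
  · obtain ⟨v, hv, hvd⟩ := hdeg
    have h1 := hsub _ (erase_ssubset hv)
    have h2 : #(Y.erase v) + 1 = #Y := card_erase_add_one hv
    rw [twiceEdges_erase hv, ← h2, mul_add]
    omega
  · push Not at hdeg
    obtain ⟨l, hl, hlne, hmax⟩ := exists_longest_path (G := G) hne
    have hlen := hY l hl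
    have hcl := hl.closed_of_longest hmax hlne (by
      have := hdeg _ (hl.mem _ (List.head_mem hlne))
      have := hdeg _ (hl.mem _ (List.getLast_mem hlne))
      omega)
    have hcard := List.toFinset_card_of_nodup hl.nodup
    have hss : Y \ l.toFinset ⊂ Y := sdiff_ssubset hl.toFinset_subset
      ⟨l.head hlne, List.mem_toFinset.2 (List.head_mem hlne)⟩
    have h1 := hsub _ hss
    have h2 := card_sdiff_add_card_eq_card hl.toFinset_subset
    rw [twiceEdges_closed hl.toFinset_subset (by simpa using hcl), ← h2, mul_add]
    have h3 := twiceEdges_le_card (G := G) l.toFinset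
    have h4 : #l.toFinset * (#l.toFinset - 1) ≤ (2 * h - 1) * #l.toFinset := by
      rw [mul_comm]
      exact Nat.mul_le_mul_right _ (by omega)
    omega

/-- A vertex in a set of large minimum degree starts a long path. -/
lemma exists_path_from {K : Finset V} {d : ℕ} (hK : ∀ v ∈ K, d ≤ degIn G K v) {b : V} (hb : b ∈ K) :
    ∀ i ≤ d + 1, 1 ≤ i → ∃ l : List V, IsPathIn G K l ∧ l.length = i ∧ l.head? = some b := by
  -- Lists grow at the head, so the prescribed vertex is kept last and the path is reversed at the
  -- end.
  suffices H : ∀ i ≤ d, ∃ l : List V, IsPathIn G K l ∧ l.length = i + 1 ∧ l.getLast? = some b by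
    intro i hi hi1
    obtain ⟨l, hl, hlen, hlast⟩ := H (i - 1) (by omega)
    exact ⟨l.reverse, hl.reverse, by rw [List.length_reverse]; omega, by simpa using hlast⟩
  intro i
  induction i with
  | zero => exact fun _ => ⟨[b], .singleton hb, rfl, rfl⟩
  | succ i ih =>
    intro hi
    obtain ⟨l, hl, hlen, hlast⟩ := ih (by omega)
    cases l with
    | nil => simp at hlen
    | cons x l =>
      obtain ⟨w, hw, hwl⟩ : ∃ w ∈ {w ∈ K | G.Adj x w}, w ∉ l.toFinset := by
        by_contra! hcon
        have h1 := card_le_card (show {w ∈ K | G.Adj x w} ⊆ l.toFinset from hcon)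
        have h2 := hK x (hl.mem x List.mem_cons_self)
        have h3 := l.toFinset_card_le
        simp only [List.length_cons] at hlen
        unfold degIn at h2
        omega
      obtain ⟨hwK, hxw⟩ := mem_filter.1 hw
      refine ⟨w :: x :: l, hl.cons hxw.symm hwK ?_, by simpa using hlen, by simpa using hlast⟩
      rw [List.mem_cons, not_or]
      exact ⟨hxw.ne', fun h => hwl (List.mem_toFinset.2 h)⟩

end

/-! ### Packings of disjoint paths -/

section

variable {V : Type*} [DecidableEq V] {G : SimpleGraph V}

/-- There are `j` pairwise disjoint paths of `G` inside `Y` whose vertex lists satisfy `Q`. -/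
def Packs (G : SimpleGraph V) (Q : List V → Prop) : ℕ → Finset V → Prop
  | 0, _ => True
  | j + 1, Y => ∃ l, IsPathIn G Y l ∧ Q l ∧ Packs G Q j (Y \ l.toFinset)

/-- There are `j` pairwise disjoint paths with `L` vertices inside `Y`. -/
abbrev PacksPaths (G : SimpleGraph V) (L : ℕ) : ℕ → Finset V → Prop :=
  Packs G fun l => l.length = L

variable {Q : List V → Prop} {Y Z U W : Finset V} {i j h L : ℕ}

lemma Packs.mono (hYZ : Y ⊆ Z) (hY : Packs G Q j Y) : Packs G Q j Z := by
  induction j generalizing Y Z with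
  | zero => trivial
  | succ j ih =>
    obtain ⟨l, hl, hQ, hp⟩ := hY
    exact ⟨l, hl.mono hYZ, hQ, ih (sdiff_subset_sdiff hYZ subset_rfl) hp⟩

lemma Packs.union (hd : Disjoint Y Z) (hY : Packs G Q i Y) (hZ : Packs G Q j Z) :
    Packs G Q (i + j) (Y ∪ Z) := by
  induction i generalizing Y with
  | zero => simpa using hZ.mono subset_union_right
  | succ i ih =>
    obtain ⟨l, hl, hQ, hp⟩ := hY
    rw [Nat.add_right_comm]
    refine ⟨l, hl.mono subset_union_left, hQ, (ih (hd.mono_left sdiff_subset) hp).mono ?_⟩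
    rw [union_sdiff_distrib]
    exact union_subset_union_right (subset_sdiff.2
      ⟨subset_rfl, (hd.mono_left hl.toFinset_subset).symm⟩)

lemma packs_one_iff : Packs G Q 1 Y ↔ ∃ l, IsPathIn G Y l ∧ Q l := by
  simp [Packs]

lemma packs_one_of_path {l : List V} (hl : IsPathIn G Y l) (hL : L ≤ l.length) :
    PacksPaths G L 1 Y :=
  packs_one_iff.2 ⟨l.take L, hl.take L, by simpa using hL⟩

lemma length_lt_of_not_packs_one (hY : ¬PacksPaths G L 1 Y) {l : List V} (hl : IsPathIn G Y l) :
    l.length < L := by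
  by_contra! hL
  exact hY (packs_one_of_path hl hL)

/-- This removes the parity of `ℓ` from the search for a core: without `k` disjoint paths on `ℓ`
vertices there are none on `2 * (ℓ / 2) + 1` vertices. -/
lemma PacksPaths.shorten {L' : ℕ} (hL : L' ≤ L) (hY : PacksPaths G L j Y) :
    PacksPaths G L' j Y := by
  induction j generalizing Y with
  | zero => trivial
  | succ j ih =>
    obtain ⟨l, hl, rfl, hp⟩ := hY
    refine ⟨l.take L', hl.take L', by simpa using hL, Packs.mono ?_ (ih hp)⟩
    refine sdiff_subset_sdiff subset_rfl fun v hv => ?_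
    rw [List.mem_toFinset] at hv ⊢
    exact List.mem_of_mem_take hv

/-- A packing blocks only boundedly many common neighbours, so alternating paths can be chosen to
avoid it. -/
lemma PacksPaths.exists_small (hY : PacksPaths G L j Y) :
    ∃ Z ⊆ Y, #Z ≤ j * L ∧ PacksPaths G L j Z := by
  induction j generalizing Y with
  | zero => exact ⟨∅, empty_subset _, by simp, trivial⟩
  | succ j ih =>
    obtain ⟨l, hl, hlen, hp⟩ := hY
    obtain ⟨Z, hZ, hcard, hpZ⟩ := ih hp
    refine ⟨l.toFinset ∪ Z, union_subset hl.toFinset_subset (hZ.trans sdiff_subset), ?_, l, ?_,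
      hlen, hpZ.mono ?_⟩
    · have := card_union_le l.toFinset Z
      have := l.toFinset_card_le
      rw [add_mul, one_mul]
      omega
    · exact ⟨hl.chain, hl.nodup, fun v hv => mem_union_left _ (List.mem_toFinset.2 hv)⟩
    · rw [union_sdiff_left]
      exact subset_sdiff.2 ⟨subset_rfl, disjoint_of_subset_left hZ sdiff_disjoint⟩

/-- A path whose first vertex is joined to all of `U` absorbs `U` and `#U` vertices of `W`. -/
lemma exists_alternating {x : V} {l : List V} (hp : IsPathIn G Z (x :: l)) (hZU : Disjoint Z U)
    (hZW : Disjoint Z W) (hx : ∀ u ∈ U, G.Adj x u) (hUW : ∀ u ∈ U, ∀ w ∈ W, G.Adj u w)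
    (hc : #U ≤ #W) :
    ∃ y l', IsPathIn G (Z ∪ (U ∪ W)) (y :: l') ∧ l'.length = l.length + 2 * #U ∧
      (y = x ∨ y ∈ W) := by
  induction U using Finset.induction_on generalizing x l Z W with
  | empty => exact ⟨x, l, hp.mono subset_union_left, by simp, Or.inl rfl⟩
  | insert u U hu ih =>
    rw [card_insert_of_notMem hu] at hc
    obtain ⟨w, hw⟩ : W.Nonempty := card_pos.1 (by omega)
    have huw := hUW u (mem_insert_self _ _) w hw
    rw [disjoint_insert_right] at hZU
    have hwZ : w ∉ Z := disjoint_right.1 hZW hw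
    have hp' : IsPathIn G (insert w (insert u Z)) (w :: u :: x :: l) := by
      refine ((hp.mono ((subset_insert _ _).trans (subset_insert _ _))).cons
        (hx u (mem_insert_self _ _)).symm (by simp) fun h => hZU.1 (hp.mem _ h)).cons huw.symm
        (by simp) fun h => ?_
      rcases List.mem_cons.1 h with rfl | h
      · exact huw.ne rfl
      · exact hwZ (hp.mem _ h)
    have hwU : w ∉ U := fun h => (hUW w (mem_insert_of_mem h) w hw).ne rfl
    have huW : u ∉ W := fun h => (hUW u (mem_insert_self _ _) u h).ne rfl
    obtain ⟨y, l', hl', hlen, hy⟩ := ih hp' (W := W.erase w)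
      (by simp only [disjoint_insert_left]; exact ⟨hwU, hu, hZU.2⟩)
      (by
        simp only [disjoint_insert_left]
        exact ⟨notMem_erase _ _, fun h => huW (mem_of_mem_erase h),
          hZW.mono_right (erase_subset _ _)⟩)
      (fun u' hu' => (hUW u' (mem_insert_of_mem hu') w hw).symm)
      (fun u' hu' w' hw' => hUW u' (mem_insert_of_mem hu') w' (mem_of_mem_erase hw'))
      (by rw [card_erase_of_mem hw]; omega)
    refine ⟨y, l', hl'.mono ?_, ?_, Or.inr ?_⟩
    · intro v hv
      simp only [mem_union, mem_insert, mem_erase] at hv ⊢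
      rcases hv with (rfl | rfl | hv) | hv | hv <;> tauto
    · rw [hlen, card_insert_of_notMem hu, List.length_cons, List.length_cons]
      ring
    · rcases hy with rfl | hy
      · exact hw
      · exact mem_of_mem_erase hy

/-- A path whose first vertex has a neighbour in `U` absorbs `U` and `#U` vertices of `W`. -/
lemma exists_alternating_of_adj {x a : V} {l : List V} (hp : IsPathIn G Z (x :: l))
    (hZU : Disjoint Z U) (hZW : Disjoint Z W) (ha : a ∈ U) (hxa : G.Adj x a)
    (hUW : ∀ u ∈ U, ∀ w ∈ W, G.Adj u w) (hc : #U ≤ #W) :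
    ∃ l', IsPathIn G (Z ∪ (U ∪ W)) l' ∧ l'.length = l.length + 1 + 2 * #U := by
  have hpos := card_pos.2 ⟨a, ha⟩
  obtain ⟨w, hw⟩ : W.Nonempty := card_pos.1 (by omega)
  have haw := hUW a ha w hw
  have hwZ : w ∉ Z := disjoint_right.1 hZW hw
  have haZ : a ∉ Z := disjoint_right.1 hZU ha
  have hp' : IsPathIn G (insert w (insert a Z)) (w :: a :: x :: l) := by
    refine ((hp.mono ((subset_insert _ _).trans (subset_insert _ _))).cons
      hxa.symm (by simp) fun h => haZ (hp.mem _ h)).cons haw.symm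
      (by simp) fun h => ?_
    rcases List.mem_cons.1 h with rfl | h
    · exact haw.ne rfl
    · exact hwZ (hp.mem _ h)
  have hwU : w ∉ U := fun h => (hUW w h w hw).ne rfl
  have haW : a ∉ W := fun h => (hUW a ha a h).ne rfl
  obtain ⟨y, l', hl', hlen, -⟩ := exists_alternating hp' (U := U.erase a) (W := W.erase w)
    (by
      simp only [disjoint_insert_left]
      exact ⟨fun h => hwU (mem_of_mem_erase h), notMem_erase _ _,
        hZU.mono_right (erase_subset _ _)⟩)
    (by
      simp only [disjoint_insert_left]
      exact ⟨notMem_erase _ _, fun h => haW (mem_of_mem_erase h),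
        hZW.mono_right (erase_subset _ _)⟩)
    (fun u' hu' => (hUW u' (mem_of_mem_erase hu') w hw).symm)
    (fun u' hu' w' hw' => hUW u' (mem_of_mem_erase hu') w' (mem_of_mem_erase hw'))
    (by rw [card_erase_of_mem hw, card_erase_of_mem ha]; omega)
  refine ⟨y :: l', hl'.mono ?_, ?_⟩
  · intro v hv
    simp only [mem_union, mem_insert, mem_erase] at hv ⊢
    rcases hv with (rfl | rfl | hv) | hv | hv <;> tauto
  · rw [List.length_cons, hlen, card_erase_of_mem ha, List.length_cons, List.length_cons]
    omega

/-- Two disjoint edges, each with an end joined to all of `U`, give a path through both of them. -/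
lemma exists_path_of_two_edges {x y x' y' : V} (hxy : G.Adj x y) (hxy' : G.Adj x' y')
    (hd : Disjoint ({x, y} : Finset V) {x', y'}) (hU : U.Nonempty)
    (hZU : Disjoint ({x, y} ∪ {x', y'}) U) (hZW : Disjoint ({x, y} ∪ {x', y'}) W)
    (hx : ∀ u ∈ U, G.Adj x u) (hx' : ∀ u ∈ U, G.Adj x' u)
    (hUW : ∀ u ∈ U, ∀ w ∈ W, G.Adj u w) (hc : #U ≤ #W) :
    ∃ l, IsPathIn G ({x, y} ∪ {x', y'} ∪ (U ∪ W)) l ∧ l.length = 2 * #U + 3 := by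
  obtain ⟨a, ha⟩ := hU
  rw [disjoint_union_left] at hZU hZW
  have hpos := card_pos.2 ⟨a, ha⟩
  obtain ⟨z, l, hl, hlen, hz⟩ := exists_alternating (W := W) (U := U.erase a)
    (IsPathIn.pair (Y := {x, y}) (by simp) (by simp) hxy)
    (hZU.1.mono_right (erase_subset _ _)) hZW.1 (fun u hu => hx u (mem_of_mem_erase hu))
    (fun u hu => hUW u (mem_of_mem_erase hu)) (by rw [card_erase_of_mem ha]; omega)
  -- The end `z` is `x` or lies in `W`; in both cases the reserved vertex `a` links it to the second
  -- edge.
  have haz : G.Adj a z := by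
    rcases hz with rfl | hz
    · exact (hx a ha).symm
    · exact hUW a ha z hz
  have hax : a ∉ ({x, y} : Finset V) := disjoint_right.1 hZU.1 ha
  have hax' : a ∉ ({x', y'} : Finset V) := disjoint_right.1 hZU.2 ha
  have haW : a ∉ W := fun h => (hUW a ha a h).ne rfl
  have hdis : Disjoint ({x, y} ∪ (U.erase a ∪ W)) {x', y'} := by
    simp only [disjoint_union_left]
    exact ⟨hd, (hZU.2.mono_right (erase_subset _ _)).symm, hZW.2.symm⟩
  refine ⟨_, IsPathIn.join (a := a) (hl.mono ?_) (IsPathIn.pair ?_ ?_ hxy') haz (hx' a ha).symm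
    ?_ ?_ ?_ ?_, ?_⟩
  · intro v hv
    simp only [mem_union, mem_erase] at hv ⊢
    tauto
  · simp
  · simp
  · simp [ha]
  · intro hmem
    have := hl.mem _ hmem
    simp only [mem_union, mem_erase] at this
    tauto
  · simpa using hax'
  · intro v hv hv'
    exact disjoint_left.1 hdis (hl.mem v hv) (by simpa using hv')
  · rw [List.length_append, List.length_reverse]
    simp only [List.length_cons, hlen, card_erase_of_mem ha, List.length_nil]
    omega

/-- Each path alternates between `h` vertices of `U` and `h + 1` of `W`, starting and ending in `W`.
-/
lemma packs_of_complete (hU : #U = j * h) (hW : j * (h + 1) ≤ #W)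
    (hUW : ∀ u ∈ U, ∀ w ∈ W, G.Adj u w) : PacksPaths G (2 * h + 1) j (U ∪ W) := by
  induction j generalizing U W with
  | zero => trivial
  | succ j ih =>
    rw [add_mul, one_mul] at hU hW
    obtain ⟨U₁, hU₁, hU₁c⟩ := exists_subset_card_eq (show h ≤ #U by omega)
    obtain ⟨W₁, hW₁, hW₁c⟩ := exists_subset_card_eq (show h + 1 ≤ #W by omega)
    obtain ⟨w, hw⟩ : W₁.Nonempty := card_pos.1 (by omega)
    have hdisj : Disjoint U W := disjoint_left.2 fun v hv hv' => (hUW v hv v hv').ne rfl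
    have hwU : w ∉ U := disjoint_right.1 hdisj (hW₁ hw)
    obtain ⟨y, l, hl, hlen, -⟩ := exists_alternating (Z := {w}) (U := U₁) (W := W₁.erase w)
      (IsPathIn.singleton (mem_singleton_self w))
      (disjoint_singleton_left.2 fun h => hwU (hU₁ h))
      (disjoint_singleton_left.2 (notMem_erase _ _))
      (fun u hu => (hUW u (hU₁ hu) w (hW₁ hw)).symm)
      (fun u hu v hv => hUW u (hU₁ hu) v (hW₁ (mem_of_mem_erase hv)))
      (by rw [card_erase_of_mem hw]; omega)
    have h1 : PacksPaths G (2 * h + 1) 1 ({w} ∪ (U₁ ∪ W₁.erase w)) :=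
      packs_one_of_path hl (by rw [List.length_cons, hlen, hU₁c, List.length_nil]; omega)
    have h2 := ih (U := U \ U₁) (W := W \ W₁) (by rw [card_sdiff_of_subset hU₁]; omega)
      (by rw [card_sdiff_of_subset hW₁]; omega)
      fun u hu v hv => hUW u (mem_sdiff.1 hu).1 v (mem_sdiff.1 hv).1
    have hd : Disjoint (U \ U₁ ∪ W \ W₁) ({w} ∪ (U₁ ∪ W₁.erase w)) := by
      rw [disjoint_left] at hdisj ⊢
      intro v hv hv'
      simp only [mem_union, mem_sdiff, mem_singleton, mem_erase] at hv hv'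
      rcases hv' with rfl | hv' | hv'
      · tauto
      · have := hU₁ hv'
        rcases hv with hv | hv
        · tauto
        · exact hdisj this hv.1
      · have := hW₁ hv'.2
        rcases hv with hv | hv
        · exact hdisj hv.1 this
        · tauto
    refine (h2.union hd h1).mono fun v hv => ?_
    simp only [mem_union, mem_sdiff, mem_singleton, mem_erase] at hv ⊢
    rcases hv with (hv | hv) | rfl | hv | hv
    · exact Or.inl hv.1
    · exact Or.inr hv.1
    · exact Or.inr (hW₁ hw)
    · exact Or.inl (hU₁ hv)
    · exact Or.inr (hW₁ hv.2)

/-- Disjoint paths avoiding `U` are complemented by paths alternating between `U` and its common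
neighbours. -/
lemma packs_add_of_complete (hU : #U = j * h) (hZ : PacksPaths G (2 * h + 1) i Z)
    (hZU : Disjoint Z U) (hW : #Z + j * (h + 1) ≤ #W) (hUW : ∀ u ∈ U, ∀ w ∈ W, G.Adj u w) :
    PacksPaths G (2 * h + 1) (i + j) (Z ∪ (U ∪ W)) := by
  have h1 : PacksPaths G (2 * h + 1) j (U ∪ W \ Z) := packs_of_complete hU
    (by have := le_card_sdiff Z W; omega) fun u hu w hw => hUW u hu w (mem_sdiff.1 hw).1
  refine (hZ.union ?_ h1).mono ?_
  · rw [disjoint_union_right]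
    exact ⟨hZU, disjoint_sdiff⟩
  · exact union_subset_union_right (union_subset_union_right sdiff_subset)

/-- Paths starting in `B` can be linked in pairs by vertices that are joined to all of `B`. -/
lemma packs_of_link {A B : Finset V} (hY : Packs G
      (fun l => l.length = h ∧ ∃ b ∈ B, l.head? = some b) (2 * j) Y) (hA : j ≤ #A)
    (hYA : Disjoint Y A) (hAB : ∀ a ∈ A, ∀ b ∈ B, G.Adj a b) :
    PacksPaths G (2 * h + 1) j (Y ∪ A) := by
  induction j generalizing Y A with
  | zero => trivial
  | succ j ih =>
    obtain ⟨l₁, hl₁, ⟨hlen₁, b₁, hb₁, hh₁⟩, l₂, hl₂, ⟨hlen₂, b₂, hb₂, hh₂⟩, hp⟩ := hY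
    obtain ⟨a, ha⟩ : A.Nonempty := card_pos.1 (by omega)
    have haY : a ∉ Y := disjoint_right.1 hYA ha
    obtain ⟨s, rfl⟩ : ∃ s, l₁ = b₁ :: s := by cases l₁ <;> simp_all
    obtain ⟨t, rfl⟩ : ∃ t, l₂ = b₂ :: t := by cases l₂ <;> simp_all
    have hl₂' := hl₂.mono sdiff_subset
    refine ⟨_, IsPathIn.join (hl₁.mono subset_union_left) (hl₂'.mono subset_union_left)
      (hAB a ha b₁ hb₁) (hAB a ha b₂ hb₂) (mem_union_right _ ha) (fun h => haY (hl₁.mem _ h))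
      (fun h => haY (hl₂'.mem _ h)) ?_, ?_, ?_⟩
    · intro v hv hv'
      exact (mem_sdiff.1 (hl₂.mem v hv')).2 (List.mem_toFinset.2 hv)
    · change ((b₁ :: s).reverse ++ a :: b₂ :: t).length = 2 * h + 1
      rw [List.length_append, List.length_reverse, List.length_cons (a := a), hlen₁, hlen₂]
      ring
    · refine Packs.mono ?_ (ih (A := A.erase a) hp (by rw [card_erase_of_mem ha]; omega)
        (hYA.mono (sdiff_subset.trans sdiff_subset) (erase_subset _ _))
        fun a' ha' => hAB a' (mem_of_mem_erase ha'))
      intro v hv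
      simp only [mem_union, mem_sdiff, mem_erase, List.mem_toFinset, List.mem_append,
        List.mem_reverse, List.mem_cons] at hv ⊢
      rcases hv with ⟨⟨h1, h2⟩, h3⟩ | ⟨h1, h2⟩
      · refine ⟨Or.inl h1, ?_⟩
        have : v ≠ a := by rintro rfl; exact haY h1
        tauto
      · refine ⟨Or.inr h2, ?_⟩
        have hvY : v ∉ Y := disjoint_right.1 hYA h2
        have h3 : v ∉ b₁ :: s := fun h => hvY (hl₁.mem _ h)
        have h4 : v ∉ b₂ :: t := fun h => hvY (hl₂'.mem _ h)
        rw [List.mem_cons] at h3 h4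
        tauto

end

/-! ### Stripping a dense graph of its long paths, and pruning -/

section

variable {V : Type*} [DecidableEq V] {G : SimpleGraph V} [DecidableRel G.Adj]
  {Y Z A B : Finset V} {h j k t : ℕ}

/-- Vertices with more than `c` neighbours in `S` are charged the trivial bound `#S`. -/
lemma sum_degIn_le (S X : Finset V) (c : ℕ) :
    ∑ v ∈ X, degIn G S v ≤ c * #X + #S * #{v ∈ X | c < degIn G S v} := by
  have h1 : ∀ v ∈ X, degIn G S v ≤ c + if c < degIn G S v then #S else 0 := fun v _ => by
    split_ifs with hc
    · exact (degIn_le_card S v).trans (Nat.le_add_left _ _)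
    · omega
  refine (sum_le_sum h1).trans_eq ?_
  rw [sum_add_distrib, sum_const, smul_eq_mul, ← sum_filter, sum_const, smul_eq_mul, mul_comm c,
    mul_comm #S]

lemma twiceEdges_le_sdiff (h : A ⊆ Y) : twiceEdges G Y ≤ twiceEdges G (Y \ A) + 2 * (#A * #Y) := by
  have h1 := twiceEdges_sdiff (G := G) h
  have h2 : twiceEdges G A ≤ #A * #A := twiceEdges_le fun v _ => degIn_le_card A v
  have h3 : ∑ v ∈ Y \ A, degIn G A v ≤ #(Y \ A) * #A :=
    (sum_le_card_nsmul _ _ _ fun v _ => degIn_le_card A v).trans_eq (smul_eq_mul _ _)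
  rw [← card_sdiff_add_card_eq_card h]
  nlinarith

/-- The number of edges if each path with `2 * h + 1` vertices has few vertices with at least `h`
neighbours on it. -/
lemma twiceEdges_le_of_poor {x : ℕ} (hh : 1 ≤ h) (Y : Finset V)
    (hY : ¬PacksPaths G (2 * h + 1) (k + 1) Y)
    (hpoor : ∀ l, IsPathIn G Y l → l.length = 2 * h + 1 →
      #{v ∈ Y | h ≤ degIn G l.toFinset v} ≤ x) :
    twiceEdges G Y ≤ (2 * h - 1) * #Y +
      2 * (k * ((h - 1) * #Y + (2 * h + 1) * x + (2 * h + 1) * (2 * h + 1))) := by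
  induction k generalizing Y with
  | zero =>
    refine (twiceEdges_le_of_no_path (h := h) Y fun l hl => ?_).trans (Nat.le_add_right _ _)
    have := length_lt_of_not_packs_one hY hl
    omega
  | succ k ih =>
    by_cases hex : ∃ l, IsPathIn G Y l ∧ l.length = 2 * h + 1
    · obtain ⟨l, hl, hlen⟩ := hex
      have hsub := hl.toFinset_subset
      have hcard : #l.toFinset = 2 * h + 1 := by
        rw [List.toFinset_card_of_nodup hl.nodup, hlen]
      have h1 := ih (Y \ l.toFinset) (fun hp => hY ⟨l, hl, hlen, hp⟩) fun l' hl' hlen' =>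
        (card_le_card (filter_subset_filter _ sdiff_subset)).trans
          (hpoor l' (hl'.mono sdiff_subset) hlen')
      have h2 := sum_degIn_le (G := G) l.toFinset (Y \ l.toFinset) (h - 1)
      have h3 : #{v ∈ Y \ l.toFinset | h - 1 < degIn G l.toFinset v} ≤ x := by
        refine le_trans (card_le_card fun v hv => ?_) (hpoor l hl hlen)
        rw [mem_filter] at hv ⊢
        exact ⟨(mem_sdiff.1 hv.1).1, by omega⟩
      have h4 : #(Y \ l.toFinset) ≤ #Y := card_le_card sdiff_subset
      have h5 : twiceEdges G l.toFinset ≤ #l.toFinset * #l.toFinset :=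
        twiceEdges_le fun v _ => degIn_le_card _ v
      rw [twiceEdges_sdiff hsub]
      rw [hcard] at h2 h5
      have h6 : (2 * h - 1) * #(Y \ l.toFinset) ≤ (2 * h - 1) * #Y := Nat.mul_le_mul_left _ h4
      have h7 : (h - 1) * #(Y \ l.toFinset) ≤ (h - 1) * #Y := Nat.mul_le_mul_left _ h4
      have h8 := Nat.mul_le_mul_left (2 * h + 1) h3
      have h9 : k * ((h - 1) * #(Y \ l.toFinset) + (2 * h + 1) * x + (2 * h + 1) * (2 * h + 1)) ≤
          k * ((h - 1) * #Y + (2 * h + 1) * x + (2 * h + 1) * (2 * h + 1)) :=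
        Nat.mul_le_mul_left _ (by omega)
      rw [add_mul k 1, one_mul]
      omega
    · push Not at hex
      refine (twiceEdges_le_of_no_path (h := h) Y fun l hl => ?_).trans (Nat.le_add_right _ _)
      by_contra! hlen
      exact hex _ (hl.take (2 * h + 1)) (by rw [List.length_take]; omega)

/-- A dense graph without `k + 1` disjoint paths with `2 * h + 1` vertices loses all of them when
`k * h` suitable vertices are deleted. -/
lemma exists_stripped {C K : ℕ} (hh : 1 ≤ h) (hK : k ≤ K) (ht : (K + 1) * (2 * h + 1) ≤ t)
    (hY : ¬PacksPaths G (2 * h + 1) (k + 1) Y)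
    (he : 2 * ((k + 1) * h) * #Y ≤ twiceEdges G Y + 2 * #Y + 2 * C)
    (hN : 2 * (K * ((2 * h + 1) * ((2 * h + 1).choose h * t) + (2 * h + 1) * (2 * h + 1))) +
      2 * C + k * h < #Y) :
    ∃ A ⊆ Y, #A = k * h ∧ ¬PacksPaths G (2 * h + 1) 1 (Y \ A) := by
  induction k generalizing Y with
  | zero => exact ⟨∅, empty_subset _, by simp, by simpa using hY⟩
  | succ k ih =>
    set x := (2 * h + 1).choose h * t with hx
    -- Were every path poor, `twiceEdges_le_of_poor` would leave the density hypothesis `he`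
    -- violated by at least `#Y`, up to the constants that `hN` absorbs.
    obtain ⟨l, hl, hlen, hrich⟩ : ∃ l, IsPathIn G Y l ∧ l.length = 2 * h + 1 ∧
        x < #{v ∈ Y | h ≤ degIn G l.toFinset v} := by
      by_contra! hcon
      have h1 := twiceEdges_le_of_poor hh Y hY hcon
      obtain ⟨g, rfl⟩ := Nat.exists_eq_add_of_le' hh
      have h2 : (k + 1) * ((2 * (g + 1) + 1) * x + (2 * (g + 1) + 1) * (2 * (g + 1) + 1)) ≤
          K * ((2 * (g + 1) + 1) * x + (2 * (g + 1) + 1) * (2 * (g + 1) + 1)) :=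
        Nat.mul_le_mul_right _ hK
      rw [show 2 * (g + 1) - 1 = 2 * g + 1 by omega, Nat.add_sub_cancel] at h1
      have h3 : 2 * ((k + 1 + 1) * (g + 1)) * #Y = (2 * g + 1) * #Y +
          2 * ((k + 1) * (g * #Y)) + 2 * #Y + #Y + 2 * (k * #Y) := by ring
      have h4 : (k + 1) * (g * #Y + (2 * (g + 1) + 1) * x +
          (2 * (g + 1) + 1) * (2 * (g + 1) + 1)) = (k + 1) * (g * #Y) +
          (k + 1) * ((2 * (g + 1) + 1) * x + (2 * (g + 1) + 1) * (2 * (g + 1) + 1)) := by ring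
      omega
    have hcard : #l.toFinset = 2 * h + 1 := by
      rw [List.toFinset_card_of_nodup hl.nodup, hlen]
    obtain ⟨A₁, hA₁, hA₁c, W, hWX, hA₁t, hAW⟩ := exists_common_neighbors hcard.le
      (fun v hv => (mem_filter.1 hv).2) hrich
    have hA₁Y : A₁ ⊆ Y := hA₁.trans hl.toFinset_subset
    have hWY : W ⊆ Y := hWX.trans (filter_subset _ _)
    -- A packing that avoids `A₁` gains one alternating path through `A₁` and unused vertices of
    -- `W`.
    have hYA : ¬PacksPaths G (2 * h + 1) (k + 1) (Y \ A₁) := by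
      intro hp
      obtain ⟨Z, hZ, hZc, hpZ⟩ := hp.exists_small
      refine hY (Packs.mono ?_ (packs_add_of_complete (j := 1) (by rw [hA₁c, one_mul]) hpZ
        (disjoint_of_subset_left hZ sdiff_disjoint) (W := W) ?_
        hAW))
      · exact union_subset (hZ.trans sdiff_subset) (union_subset hA₁Y hWY)
      · have h1 : (k + 1) * (2 * h + 1) ≤ K * (2 * h + 1) := Nat.mul_le_mul_right _ hK
        rw [add_mul K, one_mul] at ht
        omega
    have hc : #(Y \ A₁) + h = #Y := by rw [← hA₁c, card_sdiff_add_card_eq_card hA₁Y]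
    -- Deleting `h` vertices lowers `twiceEdges` by at most `2 * h * #Y`, which is exactly the drop
    -- of the leading coefficient.
    have he' : 2 * ((k + 1) * h) * #(Y \ A₁) ≤
        twiceEdges G (Y \ A₁) + 2 * #(Y \ A₁) + 2 * C := by
      have h1 := twiceEdges_le_sdiff (G := G) hA₁Y
      rw [hA₁c] at h1
      have h2 : 2 * ((k + 1 + 1) * h) * #Y =
          2 * ((k + 1) * h) * #(Y \ A₁) + 2 * ((k + 1) * h) * h + 2 * (h * #Y) := by
        rw [← hc]
        ring
      have h3 : h ≤ (k + 1) * h * h := by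
        nlinarith [Nat.mul_le_mul hh hh, Nat.zero_le (k * h * h)]
      have h4 : 2 * ((k + 1) * h) * h = 2 * ((k + 1) * h * h) := by ring
      omega
    obtain ⟨A₂, hA₂, hA₂c, hA₂p⟩ := ih (by omega) hYA he' (by rw [add_mul k 1] at hN; omega)
    refine ⟨A₁ ∪ A₂, union_subset hA₁Y (hA₂.trans sdiff_subset), ?_, ?_⟩
    · rw [card_union_of_disjoint (disjoint_of_subset_right hA₂ disjoint_sdiff), hA₁c, hA₂c]
      ring
    · rwa [← sup_eq_union, ← _root_.sdiff_sdiff_left]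

/-- Twice the number of edges that meet `Y` and lie in `A ∪ Y`. -/
def load (G : SimpleGraph V) [DecidableRel G.Adj] (A Y : Finset V) : ℕ :=
  ∑ v ∈ Y, (degIn G Y v + 2 * degIn G A v)

lemma load_eq (A Y : Finset V) :
    load G A Y = twiceEdges G Y + 2 * ∑ v ∈ Y, degIn G A v := by
  rw [load, sum_add_distrib, mul_sum]
  rfl

lemma load_le {d : ℕ} (h : ∀ v ∈ Y, degIn G Y v + 2 * degIn G A v ≤ d) : load G A Y ≤ #Y * d :=
  (sum_le_card_nsmul _ _ _ h).trans_eq (smul_eq_mul _ _)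

lemma load_erase {v : V} (h : v ∈ Y) :
    load G A Y = load G A (Y.erase v) + 2 * (degIn G A v + degIn G Y v) := by
  rw [load_eq, load_eq, twiceEdges_erase h, ← add_sum_erase _ _ h]
  ring

lemma load_closed {K : Finset V} (h : K ⊆ Y) (hK : ∀ v ∈ K, ∀ w ∈ Y, G.Adj v w → w ∈ K) :
    load G A Y = load G A K + load G A (Y \ K) := by
  rw [load_eq, load_eq, load_eq, twiceEdges_closed h hK, ← sum_sdiff h]
  ring

lemma degIn_closed {K : Finset V} (h : K ⊆ Y) (hK : ∀ v ∈ K, ∀ w ∈ Y, G.Adj v w → w ∈ K)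
    {v : V} (hv : v ∈ K) : degIn G K v = degIn G Y v := by
  refine le_antisymm (degIn_mono h v) (card_le_card fun w hw => ?_)
  rw [mem_filter] at hw ⊢
  exact ⟨hK v hv w hw.1 hw.2, hw.2⟩

/-- Deleting vertices of small degree and small components does not decrease the density by
much, as long as there are few disjoint paths starting in `B`. -/
lemma exists_pruned {M : ℕ} (hh : 2 ≤ h) (hM : M + 3 = 2 * #A + 2 * h) (Y : Finset V) (j : ℕ)
    (hB : ∀ v ∈ Y, v ∉ B → degIn G A v < #A)
    (hp : ¬Packs G (fun l => l.length = h ∧ ∃ b ∈ B, l.head? = some b) j Y) :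
    ∃ Z ⊆ Y, load G A Y + M * #Z ≤ load G A Z + M * #Y + 4 * h * j ∧
      (∀ v ∈ Z, #A + h ≤ degIn G A v + degIn G Z v + 1) ∧
      ∀ K ⊆ Z, K.Nonempty → #K ≤ 2 * h → ¬∀ v ∈ K, ∀ w ∈ Z, G.Adj v w → w ∈ K := by
  induction Y using Finset.strongInduction generalizing j with
  | H Y ih =>
  -- `M` is one less than twice the critical degree `#A + h - 1`, so a vertex of smaller degree
  -- contributes less than `M` to the load.
  by_cases hdeg : ∃ v ∈ Y, degIn G A v + degIn G Y v + 1 < #A + h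
  · obtain ⟨v, hv, hvd⟩ := hdeg
    obtain ⟨Z, hZ, hload, hgood⟩ := ih _ (erase_ssubset hv) j
      (fun w hw => hB w (mem_of_mem_erase hw)) fun hpp => hp (hpp.mono (erase_subset _ _))
    refine ⟨Z, hZ.trans (erase_subset _ _), ?_, hgood⟩
    have h1 := load_erase (G := G) (A := A) hv
    have h2 : M * #Y = M * #(Y.erase v) + M := by rw [← card_erase_add_one hv]; ring
    omega
  push Not at hdeg
  by_cases hcl : ∃ K ⊆ Y, K.Nonempty ∧ #K ≤ 2 * h ∧ ∀ v ∈ K, ∀ w ∈ Y, G.Adj v w → w ∈ K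
  swap
  · push Not at hcl
    refine ⟨Y, subset_rfl, by omega, hdeg, fun K hK hne hc hall => ?_⟩
    obtain ⟨v, hv, w, hw, hvw, hwK⟩ := hcl K hK hne hc
    exact hwK (hall v hv w hw hvw)
  obtain ⟨K, hKY, hKne, hKc, hK⟩ := hcl
  have hss : Y \ K ⊂ Y := sdiff_ssubset hKY hKne
  have hload := load_closed (A := A) hKY hK
  have hMc : M * #Y = M * #(Y \ K) + M * #K := by
    rw [← card_sdiff_add_card_eq_card hKY]
    ring
  have hdK : ∀ v ∈ K, degIn G K v + 1 ≤ 2 * h := fun v hv => by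
    have := degIn_le_card_sub_one (G := G) hv
    have := card_pos.2 ⟨v, hv⟩
    omega
  -- A small component has load at most `M + 2` per vertex, an excess of at most `4 * h` in total.
  -- If it meets `B`, its minimum degree `h - 1` yields an `h`-vertex path from `B`, so fewer than
  -- `j` components can cause such an excess.
  by_cases hKB : ∃ b ∈ K, b ∈ B
  · obtain ⟨b, hbK, hbB⟩ := hKB
    obtain ⟨l, hl, hlen, hhead⟩ := exists_path_from (G := G) (d := h - 1) (K := K) (fun v hv => by
      have := hdeg v (hKY hv)
      rw [degIn_closed hKY hK hv]
      have := degIn_le_card (G := G) A v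
      omega) hbK h (by omega) (by omega)
    cases j with
    | zero => exact absurd trivial hp
    | succ j =>
      obtain ⟨Z, hZ, hloadZ, hgood⟩ := ih _ hss j (fun w hw => hB w (mem_sdiff.1 hw).1) fun hpp =>
        hp ⟨l, hl.mono hKY, ⟨hlen, b, hbB, hhead⟩,
          hpp.mono (sdiff_subset_sdiff subset_rfl hl.toFinset_subset)⟩
      refine ⟨Z, hZ.trans sdiff_subset, ?_, hgood⟩
      have h1 : load G A K ≤ #K * (M + 2) := load_le fun v hv => by
        have := hdK v hv
        have := degIn_le_card (G := G) A v
        omega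
      have h2 : 4 * h * (j + 1) = 4 * h * j + 4 * h := by ring
      have h3 : #K * (M + 2) = M * #K + 2 * #K := by ring
      omega
  · push Not at hKB
    obtain ⟨Z, hZ, hloadZ, hgood⟩ := ih _ hss j (fun w hw => hB w (mem_sdiff.1 hw).1) fun hpp =>
      hp (hpp.mono sdiff_subset)
    refine ⟨Z, hZ.trans sdiff_subset, ?_, hgood⟩
    -- Each vertex misses some vertex of `A`, which lowers the bound from `M + 2` to `M`.
    have h1 : load G A K ≤ #K * M := load_le fun v hv => by
      have := hdK v hv
      have := hB v (hKY hv) (hKB v hv)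
      omega
    rw [mul_comm] at h1
    omega

/-- A subgraph without long paths in which few vertices are joined to all of `A` is sparse. -/
lemma load_le_of_no_path {M : ℕ} (hM : M + 3 = 2 * #A + 2 * h) (hh : 1 ≤ h)
    (hB : ∀ v ∈ Z, v ∉ B → degIn G A v < #A)
    (hfree : ∀ l, IsPathIn G Z l → l.length ≤ 2 * h) :
    load G A Z ≤ M * #Z + 2 * #(Z ∩ B) := by
  rw [load_eq]
  have h1 := twiceEdges_le_of_no_path Z hfree
  have h2 : ∑ v ∈ Z, degIn G A v + #(Z \ B) ≤ #Z * #A := by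
    calc ∑ v ∈ Z, degIn G A v + #(Z \ B)
        = ∑ v ∈ Z, (degIn G A v + if v ∉ B then 1 else 0) := by
          rw [sum_add_distrib, ← sum_filter, sum_const, smul_eq_mul, mul_one, sdiff_eq_filter]
      _ ≤ ∑ v ∈ Z, #A := sum_le_sum fun v hv => by
          split_ifs with hvB
          · exact degIn_le_card A v
          · exact hB v hv hvB
      _ = #Z * #A := by rw [sum_const, smul_eq_mul]
  have h3 := card_sdiff_add_card_inter Z B
  have h4 : (2 * h - 1) * #Z + 2 * (#Z * #A) = M * #Z + 2 * #Z := by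
    have : 2 * h - 1 + 2 * #A = M + 2 := by omega
    rw [← add_mul, ← this]
    ring
  omega

/-- Inside a pruned subgraph, a longest path starts, up to reversal, in `B`. -/
lemma exists_long_path (hB : ∀ v ∈ Z, v ∉ B → degIn G A v < #A) (hh : 2 ≤ h)
    (hZ : Z.Nonempty) (hfree : ∀ l, IsPathIn G Z l → l.length ≤ 2 * h)
    (hdeg : ∀ v ∈ Z, #A + h ≤ degIn G A v + degIn G Z v + 1)
    (hcl : ∀ K ⊆ Z, K.Nonempty → #K ≤ 2 * h → ¬∀ v ∈ K, ∀ w ∈ Z, G.Adj v w → w ∈ K) :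
    ∃ b ∈ B, ∃ l, IsPathIn G Z (b :: l) ∧ 2 * h - 1 ≤ (b :: l).length := by
  obtain ⟨l, hl, hne, hmax⟩ := exists_longest_path (G := G) hZ
  have hlen := hfree l hl
  -- Otherwise the path would span a component of at most `2 * h` vertices, and those have been
  -- pruned.
  have hsum : degIn G Z (l.head hne) + degIn G Z (l.getLast hne) < l.length := by
    by_contra! hcon
    refine hcl l.toFinset hl.toFinset_subset ⟨_, List.mem_toFinset.2 (List.head_mem hne)⟩
      (l.toFinset_card_le.trans hlen) ?_
    simpa using hl.closed_of_longest hmax hne hcon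
  have h1 := hdeg _ (hl.mem _ (List.head_mem hne))
  have h2 := hdeg _ (hl.mem _ (List.getLast_mem hne))
  have h3 := degIn_le_card (G := G) A (l.head hne)
  have h4 := degIn_le_card (G := G) A (l.getLast hne)
  by_cases hb : l.head hne ∈ B
  · refine ⟨_, hb, l.tail, ?_, ?_⟩
    · rwa [List.cons_head_tail]
    · rw [List.cons_head_tail]
      omega
  · have hb' : l.getLast hne ∈ B := by
      by_contra hb'
      have := hB _ (hl.mem _ (List.head_mem hne)) hb
      have := hB _ (hl.mem _ (List.getLast_mem hne)) hb'
      omega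
    have hr : l.getLast hne :: l.reverse.tail = l.reverse := by
      have hne' : l.reverse ≠ [] := by simpa using hne
      rw [← List.head_reverse hne', List.cons_head_tail]
    refine ⟨_, hb', l.reverse.tail, ?_, ?_⟩
    · rw [hr]
      exact hl.reverse
    · rw [hr, List.length_reverse]
      omega

end

/-! ### Finding the last `h - 1` vertices of the core -/

section

variable {V : Type*} [DecidableEq V] {G : SimpleGraph V} [DecidableRel G.Adj]
  {Z A B S : Finset V} {h q : ℕ}

/-- A long path starting in `B` needs only one vertex of `A` to be completed, so that it can be
complemented by a path using `h - 1` vertices of `A`. -/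
lemma packs_of_side_path (hh : 2 ≤ h) (hA : #A = (q + 1) * h)
    (hAB : ∀ a ∈ A, ∀ b ∈ B, G.Adj a b) (hBZ : B ⊆ Z) (hZA : Disjoint Z A)
    (hB : 4 * h + 6 + q * (h + 1) ≤ #B) {b : V} {l : List V} (hb : b ∈ B)
    (hl : IsPathIn G Z (b :: l)) (hlen : 2 * h - 1 ≤ (b :: l).length)
    (hlen' : (b :: l).length ≤ 2 * h) (hSZ : S ⊆ Z) (hSl : Disjoint S (b :: l).toFinset)
    (hS : #S ≤ 4)
    (hside : ∀ U ⊆ A, ∀ W ⊆ B, Disjoint S W → #U = h - 1 → #W = h →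
      ∃ l', IsPathIn G (S ∪ (U ∪ W)) l' ∧ 2 * h + 1 ≤ l'.length) :
    PacksPaths G (2 * h + 1) (q + 2) (Z ∪ A) := by
  rw [add_mul, one_mul] at hA
  obtain ⟨U, hU, hUc⟩ := exists_subset_card_eq (show h - 1 ≤ #A by omega)
  have hAU : #(A \ U) = q * h + 1 := by rw [card_sdiff_of_subset hU]; omega
  obtain ⟨a, ha⟩ : (A \ U).Nonempty := card_pos.1 (by omega)
  have haA := (mem_sdiff.1 ha).1
  set P := (b :: l).toFinset with hP
  have hPZ : P ⊆ Z := hl.toFinset_subset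
  have hPc : #P ≤ 2 * h := ((b :: l).toFinset_card_le).trans hlen'
  have hPS : #(P ∪ S) ≤ 2 * h + 4 := (card_union_le _ _).trans (by omega)
  have hBPS := le_card_sdiff (P ∪ S) B
  obtain ⟨W, hW, hWc⟩ := exists_subset_card_eq (show h ≤ #(B \ (P ∪ S)) by omega)
  have hPSW : #(P ∪ S ∪ W) ≤ 3 * h + 4 := (card_union_le _ _).trans (by omega)
  have hBPSW := le_card_sdiff (P ∪ S ∪ W) B
  obtain ⟨w, hw⟩ : (B \ (P ∪ S ∪ W)).Nonempty := card_pos.1 (by omega)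
  obtain ⟨hwB, hw'⟩ := mem_sdiff.1 hw
  simp only [mem_union, not_or] at hw'
  have hAZ : ∀ v ∈ A, v ∉ Z := fun v hv hv' => disjoint_left.1 hZA hv' hv
  -- Prepending `w ∈ B` and a single `a ∈ A` to a path with at least `2 * h - 1` vertices suffices.
  have hp₁ : PacksPaths G (2 * h + 1) 1 (insert w (insert a P)) := by
    refine packs_one_of_path (l := w :: a :: b :: l) ?_ (by
      simp only [List.length_cons] at hlen ⊢
      omega)
    refine (IsPathIn.cons (x := a) ⟨hl.chain, hl.nodup, fun v hv => ?_⟩ (hAB a haA b hb) (by simp)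
      fun hm => hAZ a haA (hl.mem _ hm)).cons (hAB a haA w hwB).symm (by simp) fun hm => ?_
    · simp only [mem_insert]
      exact Or.inr (Or.inr (List.mem_toFinset.2 hv))
    · rcases List.mem_cons.1 hm with rfl | hm
      · exact hAZ _ haA (hBZ hwB)
      · exact hw'.1.1 (List.mem_toFinset.2 hm)
  have hWB : W ⊆ B := hW.trans sdiff_subset
  have hWP : ∀ v ∈ W, v ∉ P ∧ v ∉ S := fun v hv => by
    have := (mem_sdiff.1 (hW hv)).2
    rwa [mem_union, not_or] at this
  obtain ⟨l', hl', hlenl'⟩ := hside U hU W hWB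
    (disjoint_right.2 fun v hv => (hWP v hv).2) hUc hWc
  have hp₂ : PacksPaths G (2 * h + 1) 1 (S ∪ (U ∪ W)) := packs_one_of_path hl' hlenl'
  have hUZ : ∀ v ∈ U, v ∉ Z := fun v hv => hAZ v (hU hv)
  have hdis : Disjoint (insert w (insert a P)) (S ∪ (U ∪ W)) := by
    simp only [disjoint_insert_left, disjoint_union_right]
    exact ⟨⟨hw'.1.2, fun hm => hAZ a haA (hSZ hm), hSl.symm⟩,
      ⟨fun hm => hUZ w hm (hBZ hwB), (mem_sdiff.1 ha).2,
        disjoint_right.2 fun v hv hm => hUZ v hv (hPZ hm)⟩,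
      hw'.2, fun hm => hAZ a haA (hBZ (hWB hm)), disjoint_right.2 fun v hv => (hWP v hv).1⟩
  have hp := hp₁.union hdis hp₂
  have hc : #(insert w (insert a P) ∪ (S ∪ (U ∪ W))) ≤ 4 * h + 6 := by
    have h1 := card_insert_le w (insert a P)
    have h2 := card_insert_le a P
    have h3 := card_union_le S (U ∪ W)
    have h4 := card_union_le U W
    have h5 := card_union_le (insert w (insert a P)) (S ∪ (U ∪ W))
    omega
  rw [add_comm q 2]
  -- The two paths use `1 + (h - 1)` vertices of `A`; the other `q * h` carry `q` alternating paths.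
  refine (packs_add_of_complete (U := (A \ U).erase a) (W := B) (j := q)
    (by rw [card_erase_of_mem ha, hAU, Nat.add_sub_cancel]) hp ?_ (by omega)
    fun u hu w' hw'' => hAB u (mem_sdiff.1 (mem_of_mem_erase hu)).1 w' hw'').mono ?_
  · rw [disjoint_right]
    intro v hv hm
    obtain ⟨hva, hv⟩ := mem_erase.1 hv
    obtain ⟨hvA, hvU⟩ := mem_sdiff.1 hv
    have hvZ := hAZ v hvA
    simp only [mem_union, mem_insert] at hm
    rcases hm with (rfl | rfl | hm) | hm | hm | hm
    · exact hvZ (hBZ hwB)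
    · exact hva rfl
    · exact hvZ (hPZ hm)
    · exact hvZ (hSZ hm)
    · exact hvU hm
    · exact hvZ (hBZ (hWB hm))
  · intro v hv
    simp only [mem_union, mem_insert, mem_erase, mem_sdiff] at hv ⊢
    rcases hv with ((rfl | rfl | hv) | hv | hv | hv) | hv | hv
    · exact Or.inl (hBZ hwB)
    · exact Or.inr haA
    · exact Or.inl (hPZ hv)
    · exact Or.inl (hSZ hv)
    · exact Or.inr (hU hv)
    · exact Or.inl (hBZ (hWB hv))
    · exact Or.inr hv.2.1
    · exact Or.inl (hBZ hv)

/-- All but two vertices of `B` outside a long path starting in `B` have all their neighbours on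
this path. -/
lemma card_bad_le_two (hh : 2 ≤ h) (hA : #A = (q + 1) * h)
    (hAB : ∀ a ∈ A, ∀ b ∈ B, G.Adj a b) (hBZ : B ⊆ Z) (hZA : Disjoint Z A)
    (hB : 4 * h + 6 + q * (h + 1) ≤ #B) {b : V} {l : List V} (hb : b ∈ B)
    (hl : IsPathIn G Z (b :: l)) (hlen : 2 * h - 1 ≤ (b :: l).length)
    (hlen' : (b :: l).length ≤ 2 * h) (hY : ¬PacksPaths G (2 * h + 1) (q + 2) (Z ∪ A)) :
    #{v ∈ B \ (b :: l).toFinset | ∃ x ∈ Z \ (b :: l).toFinset, G.Adj v x} ≤ 2 := by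
  set P := (b :: l).toFinset with hP
  rcases {v ∈ B \ P | ∃ x ∈ Z \ P, G.Adj v x}.eq_empty_or_nonempty with h0 | ⟨v, hv⟩
  · simp [h0]
  obtain ⟨hvBP, x, hxZP, hvx⟩ := mem_filter.1 hv
  obtain ⟨hvB, hvP⟩ := mem_sdiff.1 hvBP
  obtain ⟨hxZ, hxP⟩ := mem_sdiff.1 hxZP
  -- Three side vertices and `h - 1` vertices of `A` give a path on `3 + 2 * (h - 1) = 2 * h + 1`
  -- vertices.
  have hpath : ∀ x₁ x₂ x₃ : V, x₁ ∈ B → x₂ ∈ Z → x₃ ∈ Z → x₁ ∉ P → x₂ ∉ P → x₃ ∉ P →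
      G.Adj x₁ x₂ → G.Adj x₂ x₃ → x₁ ≠ x₃ → False := by
    intro x₁ x₂ x₃ h₁ h₂ h₃ n₁ n₂ n₃ a₁ a₂ hne
    refine hY (packs_of_side_path (S := {x₁, x₂, x₃}) hh hA hAB hBZ hZA hB hb hl hlen hlen' ?_ ?_ ?_
      fun U hU W hW hSW hUc hWc => ?_)
    · simp only [insert_subset_iff, singleton_subset_iff]
      exact ⟨hBZ h₁, h₂, h₃⟩
    · simp only [disjoint_insert_left, disjoint_singleton_left]
      exact ⟨n₁, n₂, n₃⟩
    · exact card_le_three.trans (by norm_num)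
    · have hSU : Disjoint ({x₁, x₂, x₃} : Finset V) U := by
        refine (hZA.mono_right hU).mono_left ?_
        simp only [insert_subset_iff, singleton_subset_iff]
        exact ⟨hBZ h₁, h₂, h₃⟩
      obtain ⟨y, l', hl', hlen'', -⟩ := exists_alternating (Z := {x₁, x₂, x₃})
        ((IsPathIn.pair (Y := {x₁, x₂, x₃}) (by simp) (by simp) a₂).cons a₁ (by simp)
          (by simp [a₁.ne, hne])) hSU hSW (fun u hu => (hAB u (hU hu) x₁ h₁).symm)
        (fun u hu w hw => hAB u (hU hu) w (hW hw)) (by omega)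
      refine ⟨_, hl', ?_⟩
      simp only [List.length_cons, List.length_nil] at hlen'' ⊢
      omega
  -- A bad vertex other than `v` and `x` gives a second edge, which either shares a vertex with the
  -- first, forming a three-vertex path, or is disjoint from it. Both are excluded.
  refine (card_le_card fun v' hv' => ?_).trans (card_le_two (a := v) (b := x))
  obtain ⟨hvBP', x', hxZP', hvx'⟩ := mem_filter.1 hv'
  obtain ⟨hvB', hvP'⟩ := mem_sdiff.1 hvBP'
  obtain ⟨hxZ', hxP'⟩ := mem_sdiff.1 hxZP'
  by_contra hcon
  simp only [mem_insert, mem_singleton, not_or] at hcon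
  by_cases h1 : x' = x
  · subst h1
    exact hpath v x' v' hvB hxZ (hBZ hvB') hvP hxP hvP' hvx hvx'.symm (Ne.symm hcon.1)
  by_cases h2 : x' = v
  · subst h2
    exact hpath v' x' x hvB' (hBZ hvB) hxZ hvP' hvP hxP hvx' hvx hcon.2
  have hSZ : ({v, x} ∪ {v', x'} : Finset V) ⊆ Z := by
    simp only [union_subset_iff, insert_subset_iff, singleton_subset_iff]
    exact ⟨⟨hBZ hvB, hxZ⟩, hBZ hvB', hxZ'⟩
  refine hY (packs_of_side_path (S := {v, x} ∪ {v', x'}) hh hA hAB hBZ hZA hB hb hl hlen hlen' hSZ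
    ?_ ?_ fun U hU W hW hSW hUc hWc => ?_)
  · simp only [disjoint_union_left, disjoint_insert_left, disjoint_singleton_left]
    exact ⟨⟨hvP, hxP⟩, hvP', hxP'⟩
  · exact (card_union_le _ _).trans (Nat.add_le_add card_le_two card_le_two)
  · obtain ⟨l', hl', hlen''⟩ := exists_path_of_two_edges (U := U) (W := W) hvx hvx' (by
        simp only [disjoint_insert_left, disjoint_singleton_left, mem_insert, mem_singleton, not_or]
        exact ⟨⟨Ne.symm hcon.1, Ne.symm h2⟩, Ne.symm hcon.2, Ne.symm h1⟩)
      (card_pos.1 (by omega)) ((hZA.mono_right hU).mono_left hSZ) hSW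
      (fun u hu => (hAB u (hU hu) v hvB).symm) (fun u hu => (hAB u (hU hu) v' hvB').symm)
      (fun u hu w hw => hAB u (hU hu) w (hW hw)) (by omega)
    exact ⟨l', hl', by omega⟩

/-- A dense graph without `k = q + 2` disjoint paths with `2 * h + 1` vertices has `k * h - 1`
vertices with many common neighbours. -/
theorem exists_core [Fintype V] (hh : 2 ≤ h)
    (hG : ¬PacksPaths G (2 * h + 1) (q + 2) univ)
    (he : 2 * ((q + 2) * h) * Fintype.card V ≤
      twiceEdges G univ + 2 * Fintype.card V + 2 * ((q + 2) * h) ^ 2)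
    (hn : 100 * ((q + 2) * h) ^ 2 * (2 * h + 1).choose h ≤ Fintype.card V) :
    ∃ U : Finset V, #U + 1 = (q + 2) * h ∧
      ∃ W : Finset V, 3 * ((q + 2) * (2 * h + 1)) ≤ #W ∧ ∀ u ∈ U, ∀ w ∈ W, G.Adj u w := by
  set n := Fintype.card V with hndef
  set c := (2 * h + 1).choose h with hc
  set s := (q + 2) * h with hs
  set t := 3 * ((q + 2) * (2 * h + 1)) with ht
  have hc1 : 1 ≤ c := Nat.choose_pos (by omega)
  have hs1 : 2 * (q + 2) ≤ s := by rw [hs, mul_comm]; exact Nat.mul_le_mul_left _ hh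
  have hs2 : 2 * h ≤ s := Nat.mul_le_mul_right _ (by omega)
  have hsL : (q + 2) * (2 * h + 1) = 2 * s + (q + 2) := by rw [hs]; ring
  have hqh : (q + 1) * h + h = s := by rw [hs]; ring
  have hqL : (q + 1) * (2 * h + 1) ≤ 3 * s := by
    have : (q + 1) * (2 * h + 1) ≤ (q + 2) * (2 * h + 1) := Nat.mul_le_mul_right _ (by omega)
    omega
  have htle : t ≤ 8 * s := by omega
  have hsc : s * s ≤ s * s * c := Nat.le_mul_of_pos_right _ hc1
  have hs4 : 4 * s ≤ s * s := Nat.mul_le_mul_right _ (by omega)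
  have hn' : 100 * (s * s * c) ≤ n := by
    refine le_trans (le_of_eq ?_) hn
    ring
  have hs' : ((q + 2) * h) ^ 2 = s * s := by rw [← hs]; ring
  obtain ⟨A, -, hA, hAp⟩ := exists_stripped (G := G) (k := q + 1) (K := q + 1) (h := h) (t := t)
    (C := s * s) (Y := univ) (by omega) le_rfl (by change (q + 2) * (2 * h + 1) ≤ t; omega) hG
    (by rwa [card_univ, ← hs']) (by
      rw [card_univ, ← hc]
      have h1 : (q + 1) * ((2 * h + 1) * (c * t) + (2 * h + 1) * (2 * h + 1)) =
          (q + 1) * (2 * h + 1) * (c * t + (2 * h + 1)) := by ring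
      have h2 : (q + 1) * (2 * h + 1) * (c * t + (2 * h + 1)) ≤ 3 * s * (c * (8 * s) + 2 * s) :=
        Nat.mul_le_mul hqL (Nat.add_le_add (Nat.mul_le_mul_left _ htle) (by omega))
      have h3 : 3 * s * (c * (8 * s) + 2 * s) = 24 * (s * s * c) + 6 * (s * s) := by ring
      omega)
  set Y := univ \ A with hY
  set B₀ : Finset V := univ.filter fun v => degIn G A v = #A with hB₀
  have hB : ∀ Z : Finset V, ∀ v ∈ Z, v ∉ B₀ → degIn G A v < #A := fun Z v _ hv =>
    lt_of_le_of_ne (degIn_le_card A v) fun heq => hv (by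
      rw [hB₀, mem_filter]
      exact ⟨mem_univ _, heq⟩)
  have hAB₀ : ∀ a ∈ A, ∀ b ∈ B₀, G.Adj a b := fun a ha b hb =>
    (degIn_eq_card_iff.1 (mem_filter.1 hb).2 a ha).symm
  have hYA : Disjoint Y A := sdiff_disjoint
  -- Linked in pairs through `A`, these paths would give `q + 2` paths on `2 * h + 1` vertices.
  have hlink : ¬Packs G (fun l => l.length = h ∧ ∃ b ∈ B₀, l.head? = some b) (2 * (q + 2)) Y :=
    fun hp => hG ((packs_of_link hp (by rw [hA]; nlinarith) hYA hAB₀).mono (subset_univ _))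
  obtain ⟨M, hM⟩ : ∃ M, M + 3 = 2 * #A + 2 * h := ⟨2 * #A + 2 * h - 3, by omega⟩
  obtain ⟨Z, hZY, hload, hdeg, hcl⟩ := exists_pruned (G := G) hh hM Y _ (hB Y) hlink
  have hfree : ∀ l, IsPathIn G Z l → l.length ≤ 2 * h := fun l hl =>
    Nat.lt_succ_iff.1 (length_lt_of_not_packs_one hAp (hl.mono hZY))
  have hZA : Disjoint Z A := hYA.mono_left hZY
  have hloadZ := load_le_of_no_path hM (by omega) (hB Z) hfree
  -- Since `2 * s = M + 3`, the density hypothesis exceeds `M * n` by `n` up to `O(s²)`, while the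
  -- load bound exceeds `M * #Z` only by `2 * #(Z ∩ B₀)`.
  have hBcard : 40 * (s * s * c) ≤ #(Z ∩ B₀) := by
    have h1 := twiceEdges_sdiff (G := G) (subset_univ A)
    rw [← hY] at h1
    have h2 := load_eq (G := G) A Y
    have h3 : twiceEdges G A ≤ #A * #A := twiceEdges_le fun v _ => degIn_le_card A v
    have h4 : #A * #A ≤ s * s := Nat.mul_le_mul (by omega) (by omega)
    have h5 : #Y ≤ n := card_le_univ Y
    have h6 : M * #Y ≤ M * n := Nat.mul_le_mul_left _ h5
    have h7 : 2 * s * n = M * n + 3 * n := by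
      rw [← add_mul]
      congr 1
      omega
    have h8 : 4 * h * (2 * (q + 2)) = 8 * s := by rw [hs]; ring
    rw [hs'] at he
    omega
  have hZne : Z.Nonempty := by
    have h1 : 0 < #(Z ∩ B₀) := by nlinarith
    exact (card_pos.1 h1).mono inter_subset_left
  obtain ⟨b, hb, l, hl, hlen⟩ := exists_long_path (hB Z) hh hZne hfree hdeg hcl
  have hlen' := hfree _ hl
  set B := Z ∩ B₀ with hBdef
  have hbB : b ∈ B := mem_inter.2 ⟨hl.mem b List.mem_cons_self, hb⟩
  have hAB : ∀ a ∈ A, ∀ b ∈ B, G.Adj a b := fun a ha b hb => hAB₀ a ha b (mem_inter.1 hb).2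
  have hbad := card_bad_le_two hh hA hAB inter_subset_left hZA (by
    have : q * (h + 1) ≤ 2 * s := by rw [hs]; nlinarith
    omega) hbB hl hlen hlen' fun hp => hG (hp.mono (subset_univ _))
  set P := (b :: l).toFinset with hP
  have hPc : #P ≤ 2 * h := ((b :: l).toFinset_card_le).trans hlen'
  have hgood := card_filter_add_card_filter_not (s := B \ P) (fun v => ∃ x ∈ Z \ P, G.Adj v x)
  have hBP := le_card_sdiff P B
  obtain ⟨A', hA', hA'c, W, hW, hA't, hAW⟩ := exists_common_neighbors (G := G) (S := P)
    (X := {v ∈ B \ P | ¬∃ x ∈ Z \ P, G.Adj v x}) (c := h - 1) (t := t) hPc (fun v hv => by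
      obtain ⟨hvB, hv⟩ := mem_filter.1 hv
      have hvZ := (mem_inter.1 (mem_sdiff.1 hvB).1).1
      have h1 := hdeg v hvZ
      have h2 := degIn_le_card (G := G) A v
      have h3 : degIn G Z v ≤ degIn G P v := card_le_card fun x hx => by
        rw [mem_filter] at hx ⊢
        refine ⟨?_, hx.2⟩
        by_contra hxP
        exact hv ⟨x, mem_sdiff.2 ⟨hx.1, hxP⟩, hx.2⟩
      omega) (by
      have h1 : (2 * h).choose (h - 1) ≤ c := by
        obtain ⟨g, rfl⟩ := Nat.exists_eq_add_of_le' (show 1 ≤ h by omega)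
        rw [hc, Nat.choose_succ_succ, Nat.add_sub_cancel]
        exact Nat.le_add_right _ _
      have h2 : (2 * h).choose (h - 1) * t ≤ c * (8 * s) := Nat.mul_le_mul h1 htle
      have h3 : 8 * (c * (4 * s)) ≤ 8 * (c * (s * s)) := by gcongr
      have h4 : c * (8 * s) = 2 * (c * (4 * s)) := by ring
      have h5 : c * (s * s) = s * s * c := by ring
      omega)
  have hAA' : Disjoint A A' := (hZA.mono_left (hA'.trans hl.toFinset_subset)).symm
  refine ⟨A ∪ A', ?_, W, hA't, fun u hu v hv => ?_⟩
  · rw [card_union_of_disjoint hAA', hA, hA'c]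
    omega
  · have hvB := (mem_inter.1 (mem_sdiff.1 (mem_filter.1 (hW hv)).1).1).2
    rcases mem_union.1 hu with hu | hu
    · exact hAB₀ u hu v hvB
    · exact hAW u hu v hv

end

/-! ### Counting edges around a core -/

section

variable {V : Type*} [DecidableEq V] [Fintype V] {G : SimpleGraph V} [DecidableRel G.Adj]
  {U W : Finset V} {h q ℓ : ℕ}

/-- A path with `ℓ` vertices, at most `h - 1` of them in `U`, is complemented by `q + 1` paths
alternating between `U` and its common neighbours. -/
lemma packs_of_path (hℓ : ℓ ≤ 2 * h + 1) (hU : #U + 1 = (q + 2) * h)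
    (hW : 3 * ((q + 2) * (2 * h + 1)) ≤ #W) (hUW : ∀ u ∈ U, ∀ w ∈ W, G.Adj u w) {l : List V}
    (hl : IsPathIn G univ l) (hlen : ℓ ≤ l.length) (hUl : #(U ∩ l.toFinset) + 1 ≤ h) :
    PacksPaths G ℓ (q + 2) univ := by
  set T := (l.take ℓ).toFinset with hT
  have hTc : #T ≤ ℓ := ((l.take ℓ).toFinset_card_le).trans (List.length_take_le _ _)
  have hTl : T ⊆ l.toFinset := fun v hv => by
    rw [hT, List.mem_toFinset] at hv
    exact List.mem_toFinset.2 (List.mem_of_mem_take hv)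
  have h1 := card_sdiff_add_card_inter U T
  have h2 : #(U ∩ T) ≤ #(U ∩ l.toFinset) := card_le_card (inter_subset_inter_left hTl)
  have h3 : (q + 2) * h = (q + 1) * h + h := by ring
  -- Of the `(q + 2) * h - 1` vertices of `U`, at most `h - 1` are lost.
  obtain ⟨U', hU', hU'c⟩ := exists_subset_card_eq (show (q + 1) * h ≤ #(U \ T) by omega)
  have h4 := le_card_sdiff T W
  have h5 : (q + 1) * (h + 1) + (2 * h + 1) ≤ (q + 2) * (2 * h + 1) := by nlinarith
  have hp : PacksPaths G ℓ (q + 1) (U' ∪ W \ T) := PacksPaths.shorten hℓ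
    (packs_of_complete hU'c (by omega) fun u hu w hw =>
      hUW u (mem_sdiff.1 (hU' hu)).1 w (mem_sdiff.1 hw).1)
  have hp₁ : PacksPaths G ℓ 1 T := packs_one_of_path (l := l.take ℓ)
    ⟨hl.chain.take _, (hl.take ℓ).nodup, fun v hv => List.mem_toFinset.2 hv⟩ (by simpa using hlen)
  refine (hp.union ?_ hp₁).mono (subset_univ _)
  rw [disjoint_union_left]
  exact ⟨disjoint_of_subset_left hU' sdiff_disjoint, sdiff_disjoint⟩

/-- There are no `q + 2` disjoint paths with `ℓ` vertices, and the vertices of the `(q + 2) * h - 1`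
element set `U` have many common neighbours. -/
structure IsCore (G : SimpleGraph V) (ℓ h q : ℕ) (U W : Finset V) : Prop where
  not_packs : ¬PacksPaths G ℓ (q + 2) univ
  two_le : 2 ≤ h
  le : ℓ ≤ 2 * h + 1
  card_add_one : #U + 1 = (q + 2) * h
  le_card : 3 * ((q + 2) * (2 * h + 1)) ≤ #W
  adj : ∀ u ∈ U, ∀ w ∈ W, G.Adj u w

lemma length_lt_of_path_sdiff (hC : IsCore G ℓ h q U W) {l : List V}
    (hl : IsPathIn G (univ \ U) l) : l.length < ℓ := by
  obtain ⟨hY, hh, hℓ, hU, hW, hUW⟩ := hC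
  by_contra! hlen
  refine hY (packs_of_path hℓ hU hW hUW (hl.mono (subset_univ _)) hlen ?_)
  have : U ∩ l.toFinset = ∅ := disjoint_iff_inter_eq_empty.1
    (disjoint_of_subset_right hl.toFinset_subset disjoint_sdiff)
  rw [this, card_empty]
  omega

/-- An attached path can alternate between `h - 1` vertices of `U` and as many of `W`. It gains `2 *
(h - 1)` vertices and is still cheap enough for `packs_of_path`. -/
lemma length_lt_of_attached (hC : IsCore G ℓ h q U W) {y a : V} {l : List V}
    (hl : IsPathIn G (univ \ U) (y :: l)) (ha : a ∈ U) (hya : G.Adj y a) :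
    (y :: l).length + 2 * (h - 1) < ℓ := by
  have hlen := length_lt_of_path_sdiff hC hl
  obtain ⟨hY, hh, hℓ, hU, hW, hUW⟩ := hC
  have hUc : h ≤ #U := by nlinarith
  have hWc : 2 * (2 * h + 1) ≤ (q + 2) * (2 * h + 1) := Nat.mul_le_mul_right _ (by omega)
  have h1 : h - 1 - 1 ≤ #(U.erase a) := by rw [card_erase_of_mem ha]; omega
  obtain ⟨U', hU', hU'c⟩ := exists_subset_card_eq h1
  have haU' : a ∉ U' := fun h => notMem_erase a U (hU' h)
  set Z := (y :: l).toFinset with hZ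
  have hUZ : Disjoint Z U := disjoint_of_subset_left hl.toFinset_subset sdiff_disjoint
  have hsub : insert a U' ⊆ U := insert_subset ha (hU'.trans (erase_subset _ _))
  have hcard : #(insert a U') = h - 1 := by rw [card_insert_of_notMem haU', hU'c]; omega
  have hZc : #Z ≤ (y :: l).length := (y :: l).toFinset_card_le
  have hWZ := le_card_sdiff Z W
  have hUW' : Disjoint U W := disjoint_left.2 fun v hv hv' => (hUW v hv v hv').ne rfl
  obtain ⟨l', hl', hlen'⟩ := exists_alternating_of_adj (Z := Z) (U := insert a U') (W := W \ Z)
    ⟨hl.chain, hl.nodup, fun v hv => List.mem_toFinset.2 hv⟩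
    (hUZ.mono_right hsub) disjoint_sdiff (mem_insert_self _ _) hya
    (fun u hu w hw => hUW u (hsub hu) w (mem_sdiff.1 hw).1) (by omega)
  by_contra! hcon
  refine hY (packs_of_path hℓ hU hW hUW (hl'.mono (subset_univ _)) ?_ ?_)
  · rw [List.length_cons] at hcon
    omega
  · have : U ∩ l'.toFinset ⊆ insert a U' := fun v hv => by
      obtain ⟨hvU, hv⟩ := mem_inter.1 hv
      have := hl'.toFinset_subset hv
      simp only [mem_union, mem_sdiff] at this
      rcases this with h1 | h1 | h1
      · exact absurd hvU (disjoint_left.1 hUZ h1)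
      · exact h1
      · exact absurd h1.1 (disjoint_left.1 hUW' hvU)
    have := card_le_card this
    omega

/-- There are no two disjoint edges all of whose ends are joined to all of `U`. -/
lemma not_two_full_edges (hC : IsCore G ℓ h q U W) {x y x' y' : V}
    (hx : x ∉ U) (hy : y ∉ U) (hx' : x' ∉ U) (hy' : y' ∉ U)
    (hxy : G.Adj x y) (hxy' : G.Adj x' y') (hd : Disjoint ({x, y} : Finset V) {x', y'})
    (hxU : ∀ u ∈ U, G.Adj x u) (hxU' : ∀ u ∈ U, G.Adj x' u) : False := by
  obtain ⟨hY, hh, hℓ, hU, hW, hUW⟩ := hC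
  have hUc : h ≤ #U := by nlinarith
  have hWc : 2 * (2 * h + 1) ≤ (q + 2) * (2 * h + 1) := Nat.mul_le_mul_right _ (by omega)
  obtain ⟨U', hU', hU'c⟩ := exists_subset_card_eq (show h - 1 ≤ #U by omega)
  set Z : Finset V := {x, y} ∪ {x', y'} with hZ
  have hUZ : Disjoint Z U := by
    simp only [hZ, disjoint_union_left, disjoint_insert_left, disjoint_singleton_left]
    exact ⟨⟨hx, hy⟩, hx', hy'⟩
  have hZc : #Z ≤ 4 := (card_union_le _ _).trans (Nat.add_le_add card_le_two card_le_two)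
  have hWZ := le_card_sdiff Z W
  have hUW' : Disjoint U W := disjoint_left.2 fun v hv hv' => (hUW v hv v hv').ne rfl
  obtain ⟨l', hl', hlen'⟩ := exists_path_of_two_edges (U := U') (W := W \ Z) hxy hxy' hd
    (card_pos.1 (by omega)) (hUZ.mono_right hU') disjoint_sdiff (fun u hu => hxU u (hU' hu))
    (fun u hu => hxU' u (hU' hu)) (fun u hu w hw => hUW u (hU' hu) w (mem_sdiff.1 hw).1)
    (by omega)
  refine hY (packs_of_path hℓ hU hW hUW (hl'.mono (subset_univ _)) (by omega) ?_)
  have : U ∩ l'.toFinset ⊆ U' := fun v hv => by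
    obtain ⟨hvU, hv⟩ := mem_inter.1 hv
    have : v ∈ Z ∪ (U' ∪ W \ Z) := hl'.toFinset_subset hv
    rw [mem_union, mem_union (s := U'), mem_sdiff] at this
    rcases this with h1 | h1 | h1
    · exact absurd hvU (disjoint_left.1 hUZ h1)
    · exact h1
    · exact absurd h1.1 (disjoint_left.1 hUW' hvU)
  have := card_le_card this
  omega

/-- Vertices with at most `#U` neighbours are removed at a cost of at most `2 * #U` each. If none is
left, `Y` spans disjoint edges whose ends are joined to all of `U`, and by `not_two_full_edges`
there is only one. Its excess is 2, which `d` accounts for. -/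
lemma load_le_of_core (hC : IsCore G ℓ h q U W) {d : ℕ}
    (hd : ∀ x y, x ∉ U → y ∉ U → G.Adj x y → (∀ u ∈ U, G.Adj x u) →
      (∀ u ∈ U, G.Adj y u) → 2 ≤ d) (Y : Finset V) (hYU : Y ⊆ univ \ U) :
    load G U Y ≤ 2 * #U * #Y + d := by
  induction Y using Finset.strongInduction with
  | H Y ih =>
  rcases Y.eq_empty_or_nonempty with rfl | hYne
  · simp [load]
  by_cases hdeg : ∃ v ∈ Y, degIn G U v + degIn G Y v ≤ #U
  · obtain ⟨v, hv, hvd⟩ := hdeg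
    have h1 := ih _ (erase_ssubset hv) ((erase_subset _ _).trans hYU)
    have h2 : 2 * #U * #Y = 2 * #U * #(Y.erase v) + 2 * #U := by
      rw [← card_erase_add_one hv]
      ring
    rw [load_erase hv]
    omega
  push Not at hdeg
  have hUc : 2 * h ≤ #U + 1 := by
    rw [hC.card_add_one]
    exact Nat.mul_le_mul_right _ (by omega)
  have hℓ := hC.le
  have hh := hC.two_le
  obtain ⟨l, hl, hne, hmax⟩ := exists_longest_path (G := G) hYne
  have hnbr : ∀ l', IsPathIn G Y l' → (∀ l'', IsPathIn G Y l'' → l''.length ≤ l'.length) →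
      ∀ hne' : l' ≠ [], degIn G Y (l'.head hne') ≤ l'.length - 1 := fun l' hl' hmax' hne' => by
    rw [← List.toFinset_card_of_nodup hl'.nodup,
      ← card_erase_of_mem (List.mem_toFinset.2 (List.head_mem hne'))]
    refine card_le_card fun w hw => ?_
    obtain ⟨hwY, hw⟩ := mem_filter.1 hw
    exact mem_erase.2 ⟨hw.ne', List.mem_toFinset.2 (hl'.mem_of_adj_head hmax' hne' hwY hw)⟩
  -- The head has at most `ℓ - 2 ≤ #U` neighbours in `Y`, so it has one in `U`, and
  -- `length_lt_of_attached` applies.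
  have hlen : l.length ≤ 2 := by
    have h1 := length_lt_of_path_sdiff hC (hl.mono hYU)
    have h2 := hnbr l hl hmax hne
    have h3 := hdeg _ (hl.mem _ (List.head_mem hne))
    obtain ⟨a, ha, hxa⟩ := exists_adj_of_degIn_pos (show 0 < degIn G U (l.head hne) by omega)
    cases l with
    | nil => simp
    | cons x l =>
      have := length_lt_of_attached hC (hl.mono hYU) ha hxa
      omega
  have hpos : ∀ v ∈ Y, ∃ w ∈ Y, G.Adj v w := fun v hv => exists_adj_of_degIn_pos (by
    have := hdeg v hv
    have := degIn_le_card (G := G) U v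
    omega)
  have hdY : ∀ v ∈ Y, degIn G Y v ≤ 1 := fun v hv => by
    obtain ⟨w, hw, hvw⟩ := hpos v hv
    exact hnbr [v, w] (.pair hv hw hvw) (fun l'' hl'' => (hmax l'' hl'').trans hlen) (by simp)
  have huniq : ∀ v ∈ Y, ∀ w ∈ Y, ∀ w' ∈ Y, G.Adj v w → G.Adj v w' → w = w' :=
    fun v hv w hw w' hw' h1 h2 => card_le_one.1 (hdY v hv) w (mem_filter.2 ⟨hw, h1⟩) w'
      (mem_filter.2 ⟨hw', h2⟩)
  have hfull : ∀ v ∈ Y, ∀ u ∈ U, G.Adj v u := fun v hv => degIn_eq_card_iff.1 (by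
    have := hdeg v hv
    have := hdY v hv
    have := degIn_le_card (G := G) U v
    omega)
  have hnU : ∀ v ∈ Y, v ∉ U := fun v hv => (mem_sdiff.1 (hYU hv)).2
  obtain ⟨x, hx⟩ := hYne
  obtain ⟨y, hy, hxy⟩ := hpos x hx
  have hYxy : Y ⊆ {x, y} := by
    intro x' hx'
    by_contra hcon
    simp only [mem_insert, mem_singleton, not_or] at hcon
    obtain ⟨y', hy', hxy'⟩ := hpos x' hx'
    refine not_two_full_edges hC (hnU x hx) (hnU y hy) (hnU x' hx') (hnU y' hy')
      hxy hxy' ?_ (hfull x hx) (hfull x' hx')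
    simp only [disjoint_insert_left, disjoint_singleton_left, mem_insert, mem_singleton, not_or]
    refine ⟨⟨Ne.symm hcon.1, ?_⟩, Ne.symm hcon.2, ?_⟩
    · rintro rfl
      exact hcon.2 (huniq x hx x' hx' y hy hxy'.symm hxy)
    · rintro rfl
      exact hcon.1 (huniq y hy x' hx' x hx hxy'.symm hxy.symm)
  have h1 := hd x y (hnU x hx) (hnU y hy) hxy (hfull x hx) (hfull y hy)
  have h2 : load G U Y ≤ #Y * (1 + 2 * #U) := load_le fun v hv => by
    have := hdY v hv
    have := degIn_le_card (G := G) U v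
    omega
  have h3 : #Y ≤ 2 := (card_le_card hYxy).trans card_le_two
  have h4 : #Y * (1 + 2 * #U) = 2 * #U * #Y + #Y := by ring
  omega

end

open SimpleGraph

/-! ### Turán's theorem inside the core -/

section

variable {V : Type*} [DecidableEq V] {G : SimpleGraph V} [DecidableRel G.Adj] {U : Finset V}
  {m s : ℕ}

lemma exists_map_eq (hU : #U = m) : ∃ f : Fin m ↪ V, univ.map f = U := by
  refine ⟨(U.equivFinOfCardEq hU).symm.toEmbedding.trans (Function.Embedding.subtype _), ?_⟩
  rw [← Finset.map_map, map_univ_equiv]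
  exact U.attach_map_val

lemma cliqueFree_comap {n : ℕ} (f : Fin m ↪ V) (h : ∀ t ⊆ univ.map f, ¬G.IsNClique n t) :
    (G.comap f).CliqueFree n := fun t ht =>
  h (t.map f) (map_subset_map.2 (subset_univ t)) (ht.map.mono (map_comap_le f G))

lemma twiceEdges_le_turan (hs : 0 < s) (hU : #U = m)
    (h : ∀ t ⊆ U, ¬G.IsNClique (s + 1) t) :
    twiceEdges G U ≤ 2 * #(turanGraph m s).edgeFinset := by
  obtain ⟨f, rfl⟩ := exists_map_eq hU
  rw [twiceEdges_map]
  exact Nat.mul_le_mul_left _ ((isTuranMaximal_turanGraph hs).2 (cliqueFree_comap f h))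

/-- As `s ≤ m`, some edge is missing; adding it creates no clique on `s + 1` vertices, so Turán's
theorem bounds the enlarged graph. -/
lemma twiceEdges_add_two_le_turan (hs : 0 < s) (hsm : s ≤ m) (hU : #U = m)
    (h : ∀ t ⊆ U, ¬G.IsNClique s t) :
    twiceEdges G U + 2 ≤ 2 * #(turanGraph m s).edgeFinset := by
  classical
  obtain ⟨f, rfl⟩ := exists_map_eq hU
  have hfree := cliqueFree_comap f h
  obtain ⟨u, v, huv, hadj⟩ : ∃ u v, u ≠ v ∧ ¬(G.comap f).Adj u v := by
    by_contra! hcon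
    obtain ⟨t, -, ht⟩ := exists_subset_card_eq (show s ≤ #(univ : Finset (Fin m)) by simpa)
    exact hfree t ⟨fun a _ b _ hab => hcon a b hab, ht⟩
  have h1 : #(G.comap f).edgeFinset + 1 ≤ #(turanGraph m s).edgeFinset := by
    rw [← card_edgeFinset_sup_edge _ hadj huv]
    convert (isTuranMaximal_turanGraph (n := m) hs).2 (hfree.sup_edge u v)
  rw [twiceEdges_map]
  omega

end

/-! ### From packings to subgraph copies; the upper bounds -/

section

variable {n k ℓ : ℕ}

lemma PacksPaths.exists_family {V : Type*} [DecidableEq V] {G : SimpleGraph V} {Y : Finset V}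
    (h : PacksPaths G ℓ k Y) :
    ∃ F : Fin k → List V, (∀ i, IsPathIn G Y (F i) ∧ (F i).length = ℓ) ∧
      ∀ i j, i ≠ j → List.Disjoint (F i) (F j) := by
  induction k generalizing Y with
  | zero => exact ⟨Fin.elim0, fun i => i.elim0, fun i => i.elim0⟩
  | succ k ih =>
    obtain ⟨l, hl, hlen, hp⟩ := h
    obtain ⟨F, hF, hd⟩ := ih hp
    have hdl : ∀ i, List.Disjoint l (F i) := fun i v hv hv' =>
      (mem_sdiff.1 ((hF i).1.mem v hv')).2 (List.mem_toFinset.2 hv)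
    refine ⟨Fin.cons l F, fun i => ?_, fun i j => ?_⟩
    · refine Fin.cases ⟨hl, hlen⟩ (fun i => ?_) i
      exact ⟨(hF i).1.mono sdiff_subset, (hF i).2⟩
    · refine Fin.cases (Fin.cases (fun h => absurd rfl h) (fun j _ => hdl j) j)
        (fun i => Fin.cases (fun _ => (hdl i).symm) (fun j hij => ?_) j) i
      exact hd i j fun h => hij (congrArg Fin.succ h)

lemma PacksPaths.isContained {V : Type*} [DecidableEq V] {G : SimpleGraph V} {Y : Finset V}
    (h : PacksPaths G ℓ k Y) : disjointCopies k (pathGraph ℓ) ⊑ G := by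
  obtain ⟨F, hF, hd⟩ := h.exists_family
  have hlt : ∀ (i : Fin k) (v : Fin ℓ), (v : ℕ) < (F i).length := fun i v => by
    rw [(hF i).2]
    exact v.2
  have hadj : ∀ (i : Fin k) (u v : Fin ℓ), (u : ℕ) + 1 = v →
      G.Adj ((F i)[(u : ℕ)]'(hlt i u)) ((F i)[(v : ℕ)]'(hlt i v)) := fun i u v huv => by
    have := List.isChain_iff_getElem.1 (hF i).1.chain u (by rw [huv]; exact hlt i v)
    simpa only [huv] using this
  refine ⟨⟨⟨fun p => (F p.1)[(p.2 : ℕ)]'(hlt p.1 p.2), ?_⟩, ?_⟩⟩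
  · rintro ⟨i, u⟩ ⟨j, v⟩ ⟨hij, huv⟩
    obtain rfl : i = j := hij
    rcases pathGraph_adj.1 huv with huv | huv
    · exact hadj i u v huv
    · exact (hadj i v u huv).symm
  · rintro ⟨i, u⟩ ⟨j, v⟩ hp
    change (F i)[(u : ℕ)]'(hlt i u) = (F j)[(v : ℕ)]'(hlt j v) at hp
    by_cases hij : i = j
    · subst hij
      rw [(hF i).1.nodup.getElem_inj_iff, Fin.val_inj] at hp
      rw [hp]
    · refine absurd (List.getElem_mem (hlt j v)) (hd i j hij ?_)
      rw [← hp]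
      exact List.getElem_mem _

variable {V : Type*} [DecidableEq V] [Fintype V] {G : SimpleGraph V} [DecidableRel G.Adj] {m : ℕ}

lemma choose_two_mul_add_one_le (hℓ : 4 ≤ ℓ) :
    (2 * (ℓ / 2) + 1).choose (ℓ / 2) ≤ 2 * ℓ.choose (ℓ / 2) := by
  rcases Nat.even_or_odd' ℓ with ⟨h, rfl | rfl⟩
  · rw [Nat.mul_div_cancel_left _ two_pos]
    obtain ⟨g, rfl⟩ := Nat.exists_eq_add_of_le' (show 1 ≤ h by omega)
    have := Nat.choose_le_centralBinom g (g + 1)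
    rw [Nat.centralBinom_eq_two_mul_choose] at this
    rw [Nat.choose_succ_succ']
    omega
  · rw [show (2 * h + 1) / 2 = h by omega]
    omega

/-- Only `k * ℓ + r ≥ 8` and `ℓ / 2 + 1 ≥ 3` are needed of two factors: they give the constant `4 *
8 * 3 = 96`, where `50` is enough. -/
lemma threshold_le {r : ℕ} (hk : 2 ≤ k) (hℓ : 4 ≤ ℓ)
    (hn : 4 * k ^ 2 * ℓ ^ 2 * (k * ℓ + r) * (ℓ / 2 + 1) * ℓ.choose (ℓ / 2) ≤ n) :
    100 * (k * (ℓ / 2)) ^ 2 * (2 * (ℓ / 2) + 1).choose (ℓ / 2) ≤ n := by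
  refine le_trans ?_ hn
  have h1 := choose_two_mul_add_one_le hℓ
  have h2 : 2 * (ℓ / 2) ≤ ℓ := Nat.mul_div_le ℓ 2
  have h3 : (2 * (ℓ / 2)) ^ 2 ≤ ℓ ^ 2 := Nat.pow_le_pow_left h2 2
  have h4 : 2 * 4 ≤ k * ℓ + r := (Nat.mul_le_mul hk hℓ).trans (Nat.le_add_right _ _)
  calc 100 * (k * (ℓ / 2)) ^ 2 * (2 * (ℓ / 2) + 1).choose (ℓ / 2)
      ≤ 100 * (k * (ℓ / 2)) ^ 2 * (2 * ℓ.choose (ℓ / 2)) := Nat.mul_le_mul_left _ h1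
    _ = 50 * (k ^ 2 * (2 * (ℓ / 2)) ^ 2 * ℓ.choose (ℓ / 2)) := by ring
    _ ≤ 96 * (k ^ 2 * ℓ ^ 2 * ℓ.choose (ℓ / 2)) := by gcongr; norm_num
    _ = 4 * k ^ 2 * ℓ ^ 2 * (2 * 4) * (2 + 1) * ℓ.choose (ℓ / 2) := by ring
    _ ≤ _ := by
      gcongr
      omega

/-- A dense graph without `k` disjoint paths with `ℓ` vertices has a core. -/
theorem exists_isCore (hℓ : 4 ≤ ℓ) (q : ℕ) (hm : m + 1 = (q + 2) * (ℓ / 2))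
    (hn : 100 * ((q + 2) * (ℓ / 2)) ^ 2 * (2 * (ℓ / 2) + 1).choose (ℓ / 2) ≤ Fintype.card V)
    (hG : ¬PacksPaths G ℓ (q + 2) univ) (he : (Fintype.card V - m) * m ≤ #G.edgeFinset) :
    ∃ U W, #U = m ∧ IsCore G ℓ (ℓ / 2) q U W := by
  obtain ⟨U, hU, W, hW, hUW⟩ := exists_core (G := G) (q := q) (h := ℓ / 2) (by omega)
    (fun hp => hG (hp.shorten (by omega))) (by
      rw [twiceEdges_univ, ← hm]
      have h1 : Fintype.card V ≤ (Fintype.card V - m) + m := le_tsub_add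
      have h2 := Nat.mul_le_mul_right m h1
      nlinarith) hn
  exact ⟨U, W, by omega, hG, by omega, by omega, hU, hW, hUW⟩

variable {q h d : ℕ} {U W : Finset V}

lemma IsCore.card_edgeFinset_le (hC : IsCore G ℓ h q U W)
    (hd : ∀ x y, x ∉ U → y ∉ U → G.Adj x y → (∀ u ∈ U, G.Adj x u) →
      (∀ u ∈ U, G.Adj y u) → 2 ≤ d) :
    2 * #G.edgeFinset ≤ twiceEdges G U + 2 * ((Fintype.card V - #U) * #U) + d := by
  have h1 := load_le_of_core hC hd _ subset_rfl
  have h2 := twiceEdges_sdiff (G := G) (subset_univ U)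
  rw [load_eq] at h1
  rw [twiceEdges_univ] at h2
  have h3 : #(univ \ U) = Fintype.card V - #U := card_univ_sdiff U
  rw [h3] at h1
  have h4 : 2 * #U * (Fintype.card V - #U) = 2 * ((Fintype.card V - #U) * #U) := by ring
  omega

/-- An edge attached to `U` extends to `2 + 2 * (h - 1) = ℓ` vertices. -/
lemma IsCore.even_imp (hC : IsCore G ℓ h q U W) (hℓ : ℓ = 2 * h) {x y : V} (hx : x ∉ U)
    (hy : y ∉ U) (hxy : G.Adj x y) (hxU : ∀ u ∈ U, G.Adj x u) : False := by
  have h1 : 0 < #U := by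
    have := hC.card_add_one
    have := hC.two_le
    nlinarith
  obtain ⟨a, ha⟩ := card_pos.1 h1
  have h2 := hC.two_le
  have := length_lt_of_attached hC (IsPathIn.pair (by simpa) (by simpa) hxy) ha (hxU a ha)
  simp only [List.length_cons, List.length_nil] at this
  omega

/-- The upper bound for graphs without cliques with `r` vertices. -/
theorem IsCore.card_edgeFinset_le_of_cliqueFree {r : ℕ} (hC : IsCore G ℓ h q U W) (hU : #U = m)
    (hr : 3 ≤ r) (hrm : r ≤ m + 2) (hG : G.CliqueFree r) :
    #G.edgeFinset ≤ (Fintype.card V - m) * m + #(turanGraph m (r - 2)).edgeFinset := by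
  have hW : W.Nonempty := card_pos.1 (by have := hC.le_card; nlinarith)
  obtain ⟨w, hw⟩ := hW
  by_cases hex : ∃ x y, x ∉ U ∧ y ∉ U ∧ G.Adj x y ∧ (∀ u ∈ U, G.Adj x u) ∧ ∀ u ∈ U, G.Adj y u
  · obtain ⟨x, y, hx, hy, hxy, hxU, hyU⟩ := hex
    have h1 := hC.card_edgeFinset_le (d := 2) fun _ _ _ _ _ _ _ => le_rfl
    -- A clique on `r - 2` vertices of `U` would form one on `r` with `x` and `y`; the edge thereby
    -- missing in `U` pays for the exceptional one.
    have h2 := twiceEdges_add_two_le_turan (G := G) (show 0 < r - 2 by omega) (by omega) hU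
      fun t ht hc => by
        refine (hc.insert (a := x) fun b hb => hxU b (ht hb)).insert (a := y)
          (fun b hb => ?_) |>.not_cliqueFree ?_
        · rcases mem_insert.1 hb with rfl | hb
          · exact hxy.symm
          · exact hyU b (ht hb)
        · rwa [show r - 2 + 1 + 1 = r by omega]
    rw [hU] at h1
    omega
  · have h1 := hC.card_edgeFinset_le (d := 0) fun x y hx hy hxy hxU hyU =>
      absurd ⟨x, y, hx, hy, hxy, hxU, hyU⟩ hex
    have h2 := twiceEdges_le_turan (G := G) (show 0 < r - 2 by omega) hU fun t ht hc => by
      refine (hc.insert (a := w) fun b hb => (hC.adj b (ht hb) w hw).symm).not_cliqueFree ?_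
      rwa [show r - 2 + 1 + 1 = r by omega]
    rw [hU] at h1
    omega

/-- The upper bound for arbitrary graphs. -/
theorem IsCore.card_edgeFinset_le_choose (hC : IsCore G ℓ h q U W) (hU : #U = m)
    (hℓ : Even ℓ → ℓ = 2 * h) :
    #G.edgeFinset ≤ (Fintype.card V - m) * m + m.choose 2 + if Odd ℓ then 1 else 0 := by
  have h2 := twiceEdges_le_card (G := G) U
  have h3 : m * (m - 1) = 2 * m.choose 2 := by
    rw [Nat.choose_two_right, Nat.mul_div_cancel' (Nat.even_mul_pred_self m).two_dvd]
  have h1 := hC.card_edgeFinset_le (d := if Odd ℓ then 2 else 0) fun x y hx hy hxy hxU hyU => by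
    split_ifs with hodd
    · exact le_rfl
    · exact (hC.even_imp (hℓ (Nat.not_odd_iff_even.1 hodd)) hx hy hxy hxU).elim
  rw [hU] at h1 h2
  split_ifs at h1 ⊢ <;> omega

end

/-! ### The extremal graphs -/

section

variable {m n k ℓ : ℕ}

/-- The join of a graph on the first `m` vertices with an edgeless graph on the other `n - m`
vertices. -/
def joinEmpty (n : ℕ) (T : SimpleGraph (Fin m)) : SimpleGraph (Fin n) where
  Adj v w := (v.1 < m ∧ m ≤ w.1) ∨ (w.1 < m ∧ m ≤ v.1) ∨
    ∃ (hv : v.1 < m) (hw : w.1 < m), T.Adj ⟨v, hv⟩ ⟨w, hw⟩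
  symm := ⟨fun v w h => by
    rcases h with h | h | ⟨hv, hw, h⟩
    · exact Or.inr (Or.inl h)
    · exact Or.inl h
    · exact Or.inr (Or.inr ⟨hw, hv, h.symm⟩)⟩
  loopless := ⟨fun v h => by
    rcases h with h | h | ⟨hv, hw, h⟩
    · omega
    · omega
    · exact T.irrefl h⟩

lemma comap_joinEmpty (hmn : m ≤ n) (T : SimpleGraph (Fin m)) :
    (joinEmpty n T).comap (Fin.castLEEmb hmn) = T := by
  ext v w
  have hv := v.2
  have hw := w.2
  simp only [comap_adj, joinEmpty, Fin.castLEEmb_apply, Fin.val_castLE]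
  constructor
  · rintro (h | h | ⟨_, _, h⟩)
    · omega
    · omega
    · exact h
  · exact fun h => Or.inr (Or.inr ⟨hv, hw, h⟩)

lemma lt_or_lt_of_joinEmpty_adj {T : SimpleGraph (Fin m)} {v w : Fin n}
    (h : (joinEmpty n T).Adj v w) : v.1 < m ∨ w.1 < m := by
  rcases h with h | h | ⟨hv, -, -⟩
  · exact Or.inl h.1
  · exact Or.inr h.1
  · exact Or.inl hv

lemma card_edgeFinset_joinEmpty (hmn : m ≤ n) (T : SimpleGraph (Fin m)) [DecidableRel T.Adj]
    [DecidableRel (joinEmpty n T).Adj] :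
    #(joinEmpty n T).edgeFinset = (n - m) * m + #T.edgeFinset := by
  classical
  set U : Finset (Fin n) := univ.map (Fin.castLEEmb hmn) with hU
  have hmem : ∀ v : Fin n, v ∈ U ↔ v.1 < m := fun v => by
    rw [hU, mem_map]
    constructor
    · rintro ⟨u, -, rfl⟩
      exact u.2
    · exact fun hv => ⟨⟨v, hv⟩, mem_univ _, rfl⟩
  have hUc : #U = m := by rw [hU, card_map, card_univ, Fintype.card_fin]
  have h1 := twiceEdges_sdiff (G := joinEmpty n T) (subset_univ U)
  have h2 : twiceEdges (joinEmpty n T) (univ \ U) = 0 := sum_eq_zero fun v hv => by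
    rw [degIn_eq_zero_iff]
    intro w hw hvw
    rw [mem_sdiff, hmem] at hv hw
    rcases lt_or_lt_of_joinEmpty_adj hvw with h | h
    · exact hv.2 h
    · exact hw.2 h
  have h3 : ∑ v ∈ univ \ U, degIn (joinEmpty n T) U v = (n - m) * m := by
    rw [sum_congr rfl fun v hv => show degIn (joinEmpty n T) U v = m from ?_, sum_const,
      card_univ_sdiff, hUc, Fintype.card_fin, smul_eq_mul]
    refine (degIn_eq_card_iff.2 fun u hu => ?_).trans hUc
    rw [mem_sdiff, hmem] at hv
    exact Or.inr (Or.inl ⟨(hmem u).1 hu, not_lt.1 hv.2⟩)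
  have h4 : twiceEdges (joinEmpty n T) U = 2 * #T.edgeFinset := by
    rw [hU, twiceEdges_map]
    congr 2
    exact edgeFinset_inj.2 (comap_joinEmpty hmn T)
  rw [twiceEdges_univ, h2, h3, h4] at h1
  omega

/-- A clique has at most one vertex in the edgeless side. -/
lemma cliqueFree_joinEmpty (hmn : m ≤ n) {T : SimpleGraph (Fin m)} {s : ℕ} (hT : T.CliqueFree s) :
    (joinEmpty n T).CliqueFree (s + 1) := by
  intro t ht
  have h1 : #{v ∈ t | ¬v.1 < m} ≤ 1 := by
    refine card_le_one.2 fun v hv w hw => ?_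
    rw [mem_filter] at hv hw
    by_contra hvw
    rcases lt_or_lt_of_joinEmpty_adj (ht.1 hv.1 hw.1 hvw) with h | h
    · exact hv.2 h
    · exact hw.2 h
  have h2 := card_filter_add_card_filter_not (s := t) (fun v => v.1 < m)
  rw [ht.2] at h2
  set t' : Finset (Fin m) := {u | Fin.castLEEmb hmn u ∈ t} with ht'
  have h3 : #{v ∈ t | v.1 < m} ≤ #t' := by
    rw [← card_map (Fin.castLEEmb hmn)]
    refine card_le_card fun v hv => ?_
    obtain ⟨hvt, hv⟩ := mem_filter.1 hv
    exact mem_map.2 ⟨⟨v, hv⟩, mem_filter.2 ⟨mem_univ _, hvt⟩, rfl⟩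
  refine hT.mono (show s ≤ #t' by omega) t' ⟨fun a ha b hb hab => ?_, rfl⟩
  rw [← comap_joinEmpty hmn T]
  exact ht.1 (mem_filter.1 ha).2 (mem_filter.1 hb).2 fun h => hab ((Fin.castLEEmb hmn).injective h)

/-- The pairs of consecutive numbers starting at `ε` are disjoint; the shift `ε` chooses which of
the two pairings is used. -/
lemma le_card_filter_range {h ε : ℕ} (p : ℕ → Prop) [DecidablePred p] (hℓ : 2 * h + ε ≤ ℓ)
    (hp : ∀ i < h, p (2 * i + ε) ∨ p (2 * i + ε + 1)) : h ≤ #{j ∈ range ℓ | p j} := by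
  have hex : ∀ i, ∃ j, i < h → (2 * i + ε ≤ j ∧ j ≤ 2 * i + ε + 1) ∧ p j := fun i => by
    by_cases hi : i < h
    · rcases hp i hi with hj | hj
      · exact ⟨_, fun _ => ⟨⟨le_rfl, by omega⟩, hj⟩⟩
      · exact ⟨_, fun _ => ⟨⟨by omega, le_rfl⟩, hj⟩⟩
    · exact ⟨0, fun h => absurd h hi⟩
  choose f hf using hex
  rw [← card_range h]
  refine card_le_card_of_injOn f (fun i hi => ?_) fun i hi j hj hij => ?_
  · have hi' := List.mem_range.1 hi
    have := hf i hi'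
    simp only [coe_filter, Set.mem_ofPred_eq, mem_range]
    exact ⟨by omega, this.2⟩
  · have h1 := hf i (List.mem_range.1 hi)
    have h2 := hf j (List.mem_range.1 hj)
    omega

/-- If at most one pair of consecutive numbers violates `p`, and none if `ℓ` is even, then half of
the numbers below `ℓ` satisfy `p`. -/
lemma half_le_card_filter_range (p : ℕ → Prop) [DecidablePred p]
    (hp : ∀ j, j + 1 < ℓ → ¬p j → ¬p (j + 1) → Odd ℓ ∧
      ∀ j', j' + 1 < ℓ → ¬p j' → ¬p (j' + 1) → j' = j) :
    ℓ / 2 ≤ #{j ∈ range ℓ | p j} := by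
  by_cases hbad : ∃ i < ℓ / 2, ¬p (2 * i) ∧ ¬p (2 * i + 1)
  · obtain ⟨i, hi, h1, h2⟩ := hbad
    obtain ⟨hodd, huniq⟩ := hp (2 * i) (by omega) h1 h2
    -- The only bad pair starts at an even number, so the pairing that starts at 1 avoids it; as `ℓ`
    -- is odd, it still has `ℓ / 2` pairs.
    have hℓ := Nat.two_mul_div_two_add_one_of_odd hodd
    refine le_card_filter_range (ε := 1) p (by omega) fun j hj => ?_
    by_contra! hcon
    have := huniq (2 * j + 1) (by omega) hcon.1 hcon.2
    omega
  · push Not at hbad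
    refine le_card_filter_range (ε := 0) p (by omega) fun j hj => ?_
    by_contra! hcon
    exact hcon.2 (hbad j hj hcon.1)

/-- If at most one edge avoids the first `m` vertices, and none if `ℓ` is even, then disjoint
paths with `ℓ` vertices use at least `ℓ / 2` of these vertices each. -/
lemma le_of_isContained {G : SimpleGraph (Fin n)} {e : Sym2 (Fin n)}
    (hG : ∀ v w, G.Adj v w → v.1 < m ∨ w.1 < m ∨ (Odd ℓ ∧ s(v, w) = e))
    (h : disjointCopies k (pathGraph ℓ) ⊑ G) : k * (ℓ / 2) ≤ m := by
  classical
  obtain ⟨f⟩ := h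
  have hinj : ∀ i u v, f (i, u) = f (i, v) → u = v := fun i u v h =>
    (Prod.mk.inj (f.injective h)).2
  have hcount : ∀ i : Fin k, ℓ / 2 ≤ #{u : Fin ℓ | (f (i, u)).1 < m} := fun i => by
    set p : ℕ → Prop := fun j => ∃ hj : j < ℓ, (f (i, ⟨j, hj⟩)).1 < m with hp
    have hnp : ∀ j (hj : j < ℓ), ¬p j → ¬(f (i, ⟨j, hj⟩)).1 < m := fun j hj h1 h2 => h1 ⟨hj, h2⟩
    have hedge : ∀ j (hj : j + 1 < ℓ), ¬p j → ¬p (j + 1) →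
        Odd ℓ ∧ s(f (i, ⟨j, by omega⟩), f (i, ⟨j + 1, hj⟩)) = e := fun j hj h1 h2 => by
      have hadj : G.Adj (f (i, ⟨j, by omega⟩)) (f (i, ⟨j + 1, hj⟩)) :=
        f.toHom.map_adj ⟨rfl, pathGraph_adj.2 (Or.inl rfl)⟩
      rcases hG _ _ hadj with h | h | h
      · exact absurd h (hnp _ _ h1)
      · exact absurd h (hnp _ _ h2)
      · exact h
    refine (half_le_card_filter_range p fun j hj h1 h2 => ⟨(hedge j hj h1 h2).1,
      fun j' hj' h1' h2' => ?_⟩).trans ?_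
    · have h3 := (hedge j hj h1 h2).2.trans (hedge j' hj' h1' h2').2.symm
      rcases Sym2.eq_iff.1 h3 with ⟨h4, -⟩ | ⟨h4, h5⟩
      · exact (Fin.mk.inj (hinj _ _ _ h4)).symm
      · have := Fin.mk.inj (hinj _ _ _ h4)
        have := Fin.mk.inj (hinj _ _ _ h5)
        omega
    · rw [← card_map Fin.valEmbedding]
      refine card_le_card fun j hj => ?_
      obtain ⟨-, hj, hjm⟩ := mem_filter.1 hj
      exact mem_map.2 ⟨⟨j, hj⟩, mem_filter.2 ⟨mem_univ _, hjm⟩, rfl⟩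
  calc k * (ℓ / 2) = ∑ _i : Fin k, ℓ / 2 := by simp
    _ ≤ ∑ i : Fin k, #{u : Fin ℓ | (f (i, u)).1 < m} := sum_le_sum fun i _ => hcount i
    _ = #(univ.sigma fun i : Fin k => ({u : Fin ℓ | (f (i, u)).1 < m} : Finset (Fin ℓ))) :=
      (card_sigma _ _).symm
    _ ≤ #(range m) := by
      refine card_le_card_of_injOn (fun x => (f (x.1, x.2)).1) (fun x hx => ?_)
        fun x hx y hy hxy => ?_
      · have := (mem_sigma.1 hx).2
        simpa using this
      · have := f.injective (Fin.ext hxy)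
        obtain ⟨h1, h2⟩ := Prod.mk.inj this
        exact Sigma.ext h1 (heq_of_eq h2)
    _ = m := card_range m

lemma joinEmpty_free (hm : m + 1 = k * (ℓ / 2)) (hn : 0 < n) (T : SimpleGraph (Fin m)) :
    (disjointCopies k (pathGraph ℓ)).Free (joinEmpty n T) := fun h => by
  -- No exceptional edge occurs here, so `e` is an arbitrary value.
  have := le_of_isContained (m := m) (e := s(⟨0, hn⟩, ⟨0, hn⟩)) (fun v w hvw =>
    (lt_or_lt_of_joinEmpty_adj hvw).imp_right Or.inl) h
  omega

end

/-! ### The Turán numbers -/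

section

variable {k ℓ r n m : ℕ}

lemma free_iff_cliqueFree {V : Type*} {G : SimpleGraph V} :
    (⊤ : SimpleGraph (Fin r)).Free G ↔ G.CliqueFree r := by
  rw [← cliqueFree_iff_top_free, Fintype.card_fin]

open scoped Classical in
lemma turanNumberPair_le {b : ℕ}
    (h : ∀ G : SimpleGraph (Fin n), G.CliqueFree r → ¬PacksPaths G ℓ k univ →
      #G.edgeFinset ≤ b) :
    turanNumberPair n (⊤ : SimpleGraph (Fin r)) (disjointCopies k (pathGraph ℓ)) ≤ b := by
  refine Finset.sup_le fun G hG => ?_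
  obtain ⟨-, hK, hP⟩ := mem_filter.1 hG
  exact h G (free_iff_cliqueFree.1 hK) fun hp => hP hp.isContained

lemma le_turanNumberPair (G : SimpleGraph (Fin n)) [DecidableRel G.Adj] (hK : G.CliqueFree r)
    (hP : (disjointCopies k (pathGraph ℓ)).Free G) :
    #G.edgeFinset ≤
      turanNumberPair n (⊤ : SimpleGraph (Fin r)) (disjointCopies k (pathGraph ℓ)) := by
  classical
  unfold turanNumberPair
  refine le_trans (le_of_eq ?_) (Finset.le_sup (f := fun G => #G.edgeFinset)
    (mem_filter.2 ⟨mem_univ G, free_iff_cliqueFree.2 hK, hP⟩))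
  congr!

theorem turanNumberPair_of_le (hk : 2 ≤ k) (hℓ : 4 ≤ ℓ) (hm : m + 1 = k * (ℓ / 2)) (hr : 3 ≤ r)
    (hrm : r ≤ m + 2)
    (hn : 100 * (k * (ℓ / 2)) ^ 2 * (2 * (ℓ / 2) + 1).choose (ℓ / 2) ≤ n) (hmn : m + 2 ≤ n) :
    turanNumberPair n (⊤ : SimpleGraph (Fin r)) (disjointCopies k (pathGraph ℓ)) =
      (n - m) * m + #(turanGraph m (r - 2)).edgeFinset := by
  classical
  refine le_antisymm (turanNumberPair_le fun G hK hP => ?_) ?_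
  · by_contra! hcon
    obtain ⟨q, rfl⟩ := Nat.exists_eq_add_of_le' hk
    obtain ⟨U, W, hU, hC⟩ := exists_isCore hℓ q hm (by simpa using hn) hP
      (by rw [Fintype.card_fin]; omega)
    have := hC.card_edgeFinset_le_of_cliqueFree hU hr hrm hK
    rw [Fintype.card_fin] at this
    omega
  · rw [← card_edgeFinset_joinEmpty (by omega)]
    refine le_turanNumberPair _ ?_ (joinEmpty_free hm (by omega) _)
    have := cliqueFree_joinEmpty (show m ≤ n by omega)
      (turanGraph_cliqueFree (n := m) (show 0 < r - 2 by omega))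
    rwa [show r - 2 + 1 + 1 = r by omega] at this

theorem turanNumberPair_of_ge (hk : 2 ≤ k) (hℓ : 4 ≤ ℓ) (hm : m + 1 = k * (ℓ / 2))
    (hrm : m + 3 ≤ r)
    (hn : 100 * (k * (ℓ / 2)) ^ 2 * (2 * (ℓ / 2) + 1).choose (ℓ / 2) ≤ n) (hmn : m + 2 ≤ n) :
    turanNumberPair n (⊤ : SimpleGraph (Fin r)) (disjointCopies k (pathGraph ℓ)) =
      (n - m) * m + m.choose 2 + if Odd ℓ then 1 else 0 := by
  classical
  refine le_antisymm (turanNumberPair_le fun G hK hP => ?_) ?_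
  · by_contra! hcon
    obtain ⟨q, rfl⟩ := Nat.exists_eq_add_of_le' hk
    obtain ⟨U, W, hU, hC⟩ := exists_isCore hℓ q hm (by simpa using hn) hP
      (by rw [Fintype.card_fin]; omega)
    have := hC.card_edgeFinset_le_choose hU fun he => (Nat.two_mul_div_two_of_even he).symm
    rw [Fintype.card_fin] at this
    omega
  · have hcard := card_edgeFinset_joinEmpty (n := n) (by omega) (⊤ : SimpleGraph (Fin m))
    rw [card_edgeFinset_top_eq_card_choose_two, Fintype.card_fin] at hcard
    have hfree : (joinEmpty n (⊤ : SimpleGraph (Fin m))).CliqueFree (m + 1 + 1) :=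
      cliqueFree_joinEmpty (by omega) (cliqueFree_of_card_lt (by simp))
    split_ifs with hodd
    · set x : Fin n := ⟨m, by omega⟩ with hx
      set y : Fin n := ⟨m + 1, by omega⟩ with hy
      have hxy : x ≠ y := fun h => by simpa using Fin.mk.inj h
      have hadj : ¬(joinEmpty n (⊤ : SimpleGraph (Fin m))).Adj x y := fun h => by
        rcases lt_or_lt_of_joinEmpty_adj h with h | h <;> simp [hx, hy] at h
      rw [← hcard, ← card_edgeFinset_sup_edge _ hadj hxy]
      -- The extra edge raises the clique bound by at most one, to `m + 3 ≤ r`.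
      refine le_trans (le_of_eq ?_) (le_turanNumberPair (joinEmpty n ⊤ ⊔ edge x y)
        ((hfree.sup_edge x y).mono (by omega)) fun h => ?_)
      · congr!
      · have := le_of_isContained (m := m) (e := s(x, y)) (fun v w hvw => ?_) h
        · omega
        · rcases hvw with hvw | hvw
          · exact (lt_or_lt_of_joinEmpty_adj hvw).imp_right Or.inl
          · exact Or.inr (Or.inr ⟨hodd, (adj_edge _ _).1 hvw |>.1.symm⟩)
    · rw [add_zero, ← hcard]
      exact le_turanNumberPair _ (hfree.mono (by omega)) (joinEmpty_free hm (by omega) _)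

end

end DisjointPaths

theorem mainTheorem7 (k ℓ : ℕ) (hk : 2 ≤ k) (hℓ : 4 ≤ ℓ) :
    (∀ n : ℕ,
      4 * k ^ 2 * ℓ ^ 2 * (k * ℓ + 3) * (ℓ / 2 + 1) * ℓ.choose (ℓ / 2) ≤ n →
      turanNumberPair n (⊤ : SimpleGraph (Fin 3))
          (disjointCopies k (SimpleGraph.pathGraph ℓ)) =
        (n - k * (ℓ / 2) + 1) * (k * (ℓ / 2) - 1)) ∧
    (∀ r n : ℕ, 4 ≤ r → r ≤ k * (ℓ / 2) + 1 →
      4 * k ^ 2 * ℓ ^ 2 * (k * ℓ + r) * (ℓ / 2 + 1) * ℓ.choose (ℓ / 2) ≤ n →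
      turanNumberPair n (⊤ : SimpleGraph (Fin r))
          (disjointCopies k (SimpleGraph.pathGraph ℓ)) =
        (n - k * (ℓ / 2) + 1) * (k * (ℓ / 2) - 1) +
          (SimpleGraph.turanGraph (k * (ℓ / 2) - 1) (r - 2)).edgeFinset.card) ∧
    (∀ r n : ℕ, k * (ℓ / 2) + 2 ≤ r →
      4 * k ^ 2 * ℓ ^ 2 * (k * ℓ + r) * (ℓ / 2 + 1) * ℓ.choose (ℓ / 2) ≤ n →
      turanNumberPair n (⊤ : SimpleGraph (Fin r))
          (disjointCopies k (SimpleGraph.pathGraph ℓ)) =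
        (n - k * (ℓ / 2) + 1) * (k * (ℓ / 2) - 1) +
          (k * (ℓ / 2) - 1).choose 2 + (if Odd ℓ then 1 else 0)) := by
  have hs : 2 * 2 ≤ k * (ℓ / 2) := Nat.mul_le_mul hk (by omega)
  obtain ⟨m, hm⟩ : ∃ m, m + 1 = k * (ℓ / 2) := ⟨k * (ℓ / 2) - 1, by omega⟩
  have hlarge : ∀ n, 100 * (k * (ℓ / 2)) ^ 2 * (2 * (ℓ / 2) + 1).choose (ℓ / 2) ≤ n →
      m + 2 ≤ n := fun n hn => by
    have h1 : 0 < (2 * (ℓ / 2) + 1).choose (ℓ / 2) := Nat.choose_pos (by omega)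
    have h2 := Nat.le_mul_of_pos_right (100 * (k * (ℓ / 2)) ^ 2) h1
    nlinarith
  have hsub : ∀ n, m + 2 ≤ n → n - k * (ℓ / 2) + 1 = n - m := fun n hn => by omega
  refine ⟨fun n hn => ?_, fun r n hr hrm hn => ?_, fun r n hrm hn => ?_⟩
  · have hn' := DisjointPaths.threshold_le hk hℓ hn
    rw [DisjointPaths.turanNumberPair_of_le hk hℓ hm le_rfl (by omega) hn'
      (hlarge n hn'), hsub n (hlarge n hn'), ← hm, Nat.add_sub_cancel]
    -- For `r = 3` the Turán graph has a single part, so its contribution vanishes.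
    have hbot : SimpleGraph.turanGraph m 1 = ⊥ := by
      ext v w
      simp [SimpleGraph.turanGraph_adj, Nat.mod_one]
    rw [Nat.add_eq_left, Finset.card_eq_zero, SimpleGraph.edgeFinset_eq_empty]
    exact hbot
  · have hn' := DisjointPaths.threshold_le hk hℓ hn
    rw [DisjointPaths.turanNumberPair_of_le hk hℓ hm (by omega) (by omega) hn'
      (hlarge n hn'), hsub n (hlarge n hn'), ← hm, Nat.add_sub_cancel]
  · have hn' := DisjointPaths.threshold_le hk hℓ hn
    rw [DisjointPaths.turanNumberPair_of_ge hk hℓ hm (by omega) hn' (hlarge n hn'),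
      hsub n (hlarge n hn'), ← hm, Nat.add_sub_cancel]
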